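/- **Theorem.** There is a universal constant $c>0$ such that for all $n,t\in\mathbb{N}$, with $d=2^n$, the $n$-qubit $PFC$ ensemble is a diamond $\epsilon$-approximate $t$-design with $\epsilon = c\,t/\sqrt{d}$. Here the $n$-qubit $PFC$ ensemble is the law of the random unitary $PFC\in \mathrm{U}(d)$, where $P:|x\rangle\mapsto|\pi(x)\rangle$ for a uniformly random permutation $\pi$ of $\{0,1\}^n$, $F:|x\rangle\mapsto(-1)^{f(x)}|x\rangle$ for a uniformly random function $f:\{0,1\}^n\to\{0,1\}$, and $C$ is a uniformly random element of the $n$-qubit Clifford group (the normalizer in $\mathrm{U}(d)$ of the Pauli group; "uniformly random" means distributed by the invariant probability measure of this compact group, which is uniform on the finite quotient by global phases), and $P$, $F$, $C$ are independent. A probability distribution $\nu$ on $\mathrm{U}(d)$ is a diamond $\epsilon$-approximate $t$-design if $\|\mathcal{M}^{(t)}_\nu-\mathcal{M}^{(t)}_{\mathrm{Haar}}\|_\Diamond\le\epsilon$, where $\mathcal{M}^{(t)}_\nu(X)=\mathbb{E}_{U\sim\nu}\,U^{\otimes t}X\,(U^{\otimes t})^\dagger$ is the $t$-wise twirl, $\mathrm{Haar}$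 is the Haar probability measure on $\mathrm{U}(d)$, and, for channels $\mathcal{M},\mathcal{N}$ on $\mathrm{L}(\mathcal{H})$, $\|\mathcal{M}-\mathcal{N}\|_\Diamond=\sup_{|\psi\rangle}\|(\mathcal{M}\otimes\mathrm{id}_{\mathcal{H}})(|\psi\rangle\langle\psi|)-(\mathcal{N}\otimes\mathrm{id}_{\mathcal{H}})(|\psi\rangle\langle\psi|)\|_1$, the supremum being over unit vectors $|\psi\rangle\in\mathcal{H}\otimes\mathcal{H}$ and $\|A\|_1=\mathrm{Tr}[(A^\dagger A)^{1/2}]$. -/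

import Mathlib

open MeasureTheory
open scoped Matrix

noncomputable section

namespace PFC

/-! ### Trace norm, superoperators and the diamond distance -/

/-- The Schatten 1-norm `Tr[(A† A)^{1/2}]`; the square root is taken in the functional calculus
of the Hermitian matrix `A† A`. -/
def traceNorm {κ : Type*} [Fintype κ] [DecidableEq κ] (A : Matrix κ κ ℂ) : ℝ :=
  (cfc Real.sqrt (Aᴴ * A)).trace.re

/-- Superoperators `L(ℂ^κ) → L(ℂ^μ)`, in the standard bases. -/
abbrev Superop (κ μ : Type*) := Matrix κ κ ℂ →ₗ[ℂ] Matrix μ μ ℂ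

/-- `M ⊗ id_R`: the superoperator `M` is applied to each `R`-block of the argument. -/
def Superop.tensorId {κ μ : Type*} (M : Superop κ μ) (R : Type*) : Superop (κ × R) (μ × R) where
  toFun X := Matrix.of fun p q => M (Matrix.of fun a b => X (a, p.2) (b, q.2)) p.1 q.1
  map_add' X Y := by
    ext p q
    exact congrFun (congrFun (M.map_add (Matrix.of fun a b => X (a, p.2) (b, q.2))
      (Matrix.of fun a b => Y (a, p.2) (b, q.2))) p.1) q.1
  map_smul' c X := by
    ext p q
    exact congrFun (congrFun (M.map_smul c (Matrix.of fun a b => X (a, p.2) (b, q.2))) p.1) q.1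

/-- The rank-one operator `|ψ⟩⟨ψ|`. -/
def proj {κ : Type*} (ψ : EuclideanSpace ℂ κ) : Matrix κ κ ℂ :=
  Matrix.of fun a b => ψ a * star (ψ b)

/-- The diamond distance: the supremum, over all pure states `ψ` of the input system and an
ancilla of the same dimension, of `‖(M ⊗ id)(|ψ⟩⟨ψ|) - (N ⊗ id)(|ψ⟩⟨ψ|)‖₁`. It is taken in the
extended reals, so that no boundedness convention is involved. -/
def diamondDist {κ μ : Type*} [Fintype κ] [Fintype μ] [DecidableEq κ] [DecidableEq μ]
    (M N : Superop κ μ) : EReal :=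
  ⨆ ψ : {ψ : EuclideanSpace ℂ (κ × κ) // ‖ψ‖ = 1},
    ((traceNorm (M.tensorId κ (proj ψ.1) - N.tensorId κ (proj ψ.1)) : ℝ) : EReal)

/-! ### The unitary group as a compact group with its Borel σ-algebra -/

section Unitary

variable {ι : Type*} [Fintype ι] [DecidableEq ι]

instance : MeasurableSpace (Matrix.unitaryGroup ι ℂ) := borel _

instance : BorelSpace (Matrix.unitaryGroup ι ℂ) := ⟨rfl⟩

instance : SecondCountableTopology (Matrix ι ι ℂ) :=
  inferInstanceAs (SecondCountableTopology (ι → ι → ℂ))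

instance : SecondCountableTopology (Matrix.unitaryGroup ι ℂ) :=
  inferInstanceAs (SecondCountableTopology
    {U : Matrix ι ι ℂ // U ∈ (Matrix.unitaryGroup ι ℂ : Set (Matrix ι ι ℂ))})

instance : T2Space (Matrix ι ι ℂ) := inferInstanceAs (T2Space (ι → ι → ℂ))

instance : CompactSpace (Matrix.unitaryGroup ι ℂ) := by
  have hK : IsCompact (Set.univ.pi fun _ : ι => Set.univ.pi fun _ : ι =>
      Metric.closedBall (0 : ℂ) 1) :=
    isCompact_univ_pi fun _ => isCompact_univ_pi fun _ => isCompact_closedBall _ _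
  have hc : IsClosed {U : Matrix ι ι ℂ | U * star U = 1} :=
    isClosed_eq (continuous_id.mul continuous_star) continuous_const
  have hset : (Matrix.unitaryGroup ι ℂ : Set (Matrix ι ι ℂ)) = {U | U * star U = 1} := by
    ext U
    exact Matrix.mem_unitaryGroup_iff
  refine isCompact_iff_compactSpace.mp (hK.of_isClosed_subset (hset ▸ hc) ?_)
  intro U hU i _ j _
  simpa using entry_norm_bound_of_unitary hU i j

end Unitary

/-- The invariant (Haar) probability measure of a compact group. -/
def haarProb (G : Type*) [Group G] [TopologicalSpace G] [IsTopologicalGroup G] [CompactSpace G]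
    [MeasurableSpace G] [BorelSpace G] : ProbabilityMeasure G :=
  ⟨Measure.haarMeasure ⊤, ⟨by
    simpa using Measure.haarMeasure_self (K₀ := (⊤ : TopologicalSpace.PositiveCompacts G))⟩⟩

/-! ### Ensembles of unitaries, twirls and approximate designs -/

section Design

variable {ι : Type*} [Fintype ι] [DecidableEq ι]

/-- The `t`-fold tensor power `U^{⊗t}` as a matrix in the product basis of `(ℂ^ι)^{⊗t}`. -/
def tensorPow (t : ℕ) (U : Matrix ι ι ℂ) : Matrix (Fin t → ι) (Fin t → ι) ℂ :=
  Matrix.of fun a b => ∏ k, U (a k) (b k)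

theorem integrable_twirl (ν : ProbabilityMeasure (Matrix.unitaryGroup ι ℂ)) (t : ℕ)
    (X : Matrix (Fin t → ι) (Fin t → ι) ℂ) (a b : Fin t → ι) :
    Integrable (fun U : Matrix.unitaryGroup ι ℂ =>
      (tensorPow t U.1 * X * (tensorPow t U.1)ᴴ) a b) (ν : Measure _) := by
  have hT : Continuous fun U : Matrix.unitaryGroup ι ℂ => tensorPow t U.1 := by
    refine continuous_matrix fun i j => ?_
    simp only [tensorPow, Matrix.of_apply]
    exact continuous_finsetProd _ fun k _ => continuous_subtype_val.matrix_elem (i k) (j k)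
  have hc : Continuous fun U : Matrix.unitaryGroup ι ℂ =>
      (tensorPow t U.1 * X * (tensorPow t U.1)ᴴ) a b :=
    ((hT.matrix_mul continuous_const).matrix_mul hT.matrix_conjTranspose).matrix_elem a b
  exact hc.integrable_of_hasCompactSupport (HasCompactSupport.of_compactSpace _)

/-- The `t`-wise twirl `X ↦ 𝔼_{U ∼ ν} U^{⊗t} X (U^{⊗t})†`, the expectation being taken
entrywise. -/
def twirl (ν : ProbabilityMeasure (Matrix.unitaryGroup ι ℂ)) (t : ℕ) :
    Superop (Fin t → ι) (Fin t → ι) where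
  toFun X := Matrix.of fun a b =>
    ∫ U : Matrix.unitaryGroup ι ℂ, (tensorPow t U.1 * X * (tensorPow t U.1)ᴴ) a b ∂(ν : Measure _)
  map_add' X Y := by
    ext a b
    simp only [Matrix.of_apply, Matrix.add_apply, Matrix.mul_add, Matrix.add_mul]
    exact integral_add (integrable_twirl ν t X a b) (integrable_twirl ν t Y a b)
  map_smul' c X := by
    ext a b
    simp only [Matrix.of_apply, Matrix.smul_apply, Matrix.mul_smul, Matrix.smul_mul,
      RingHom.id_apply]
    exact integral_smul c _

/-- `ν` is a diamond `ε`-approximate `t`-design: its `t`-wise twirl is within diamond distance `ε`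
of the `t`-wise twirl of the Haar measure on the unitary group. -/
def IsDiamondApproxDesign (ν : ProbabilityMeasure (Matrix.unitaryGroup ι ℂ)) (ε : ℝ) (t : ℕ) :
    Prop :=
  diamondDist (twirl ν t) (twirl (haarProb (Matrix.unitaryGroup ι ℂ)) t) ≤ (ε : EReal)

end Design

/-! ### The PFC ensemble -/

/-- Labels of the computational basis of `n` qubits. -/
abbrev Bits (n : ℕ) := Fin n → Fin 2

/-- The unitary group `U(2^n)` on `n` qubits. -/
abbrev QU (n : ℕ) := Matrix.unitaryGroup (Bits n) ℂ

/-- The permutation operator `|x⟩ ↦ |π x⟩`. -/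
def permUnitary {n : ℕ} (π : Equiv.Perm (Bits n)) : QU n :=
  ⟨Matrix.of fun y x => if y = π x then 1 else 0, by
    rw [Matrix.mem_unitaryGroup_iff']
    ext x y
    simp [Matrix.mul_apply, Matrix.one_apply, Matrix.star_apply, eq_comm]⟩

/-- The binary phase operator `|x⟩ ↦ (-1)^{f x} |x⟩`. -/
def phaseUnitary {n : ℕ} (f : Bits n → Fin 2) : QU n :=
  ⟨Matrix.diagonal fun x => (-1 : ℂ) ^ (f x : ℕ), by
    rw [Matrix.mem_unitaryGroup_iff', Matrix.star_eq_conjTranspose, Matrix.diagonal_conjTranspose,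
      Matrix.diagonal_mul_diagonal, ← Matrix.diagonal_one]
    congr 1
    funext x
    simp [← mul_pow]⟩

/-- The single-qubit Pauli matrices `1, X, Y, Z`. -/
def pauli : Fin 4 → Matrix (Fin 2) (Fin 2) ℂ :=
  ![1, !![0, 1; 1, 0], !![0, -Complex.I; Complex.I, 0], !![1, 0; 0, -1]]

/-- The Pauli string `σ_{p 0} ⊗ ⋯ ⊗ σ_{p (n-1)}`. -/
def pauliString {n : ℕ} (p : Fin n → Fin 4) : Matrix (Bits n) (Bits n) ℂ :=
  Matrix.of fun x y => ∏ k, pauli (p k) (x k) (y k)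

theorem pauli_mul (a b : Fin 4) :
    ∃ (k : ℕ) (c : Fin 4), pauli a * pauli b = Complex.I ^ k • pauli c := by
  have hI : Complex.I ^ 3 = -Complex.I := Complex.I_pow_three
  fin_cases a <;> fin_cases b
  · exact ⟨0, 0, by simp [pauli]⟩
  · exact ⟨0, 1, by simp [pauli]⟩
  · exact ⟨0, 2, by simp [pauli]⟩
  · exact ⟨0, 3, by simp [pauli]⟩
  · exact ⟨0, 1, by simp [pauli]⟩
  · exact ⟨0, 0, by simp [pauli, Matrix.one_fin_two]⟩
  · exact ⟨1, 3, by simp [pauli]⟩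
  · exact ⟨3, 2, by simp [pauli, hI]⟩
  · exact ⟨0, 2, by simp [pauli]⟩
  · exact ⟨3, 3, by simp [pauli, hI]⟩
  · exact ⟨0, 0, by simp [pauli, Matrix.one_fin_two]⟩
  · exact ⟨1, 1, by simp [pauli]⟩
  · exact ⟨0, 3, by simp [pauli]⟩
  · exact ⟨1, 2, by simp [pauli]⟩
  · exact ⟨3, 1, by simp [pauli, hI]⟩
  · exact ⟨0, 0, by simp [pauli, Matrix.one_fin_two]⟩

theorem pauli_conjTranspose (a : Fin 4) : (pauli a)ᴴ = pauli a := by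
  fin_cases a <;> ext i j <;> fin_cases i <;> fin_cases j <;> simp [pauli]

theorem pauliString_mul {n : ℕ} (p q : Fin n → Fin 4) :
    ∃ (k : ℕ) (r : Fin n → Fin 4),
      pauliString p * pauliString q = Complex.I ^ k • pauliString r := by
  choose k r h using fun i => pauli_mul (p i) (q i)
  refine ⟨∑ i, k i, r, ?_⟩
  ext x y
  have h' : ∀ i, ∑ z, pauli (p i) (x i) z * pauli (q i) z (y i) =
      Complex.I ^ k i * pauli (r i) (x i) (y i) := fun i => by
    simpa [Matrix.mul_apply] using congrFun (congrFun (h i) (x i)) (y i)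
  simp only [pauliString, Matrix.mul_apply, Matrix.of_apply, Matrix.smul_apply, smul_eq_mul,
    ← Finset.prod_mul_distrib, ← Finset.prod_pow_eq_pow_sum, ← h']
  exact (Finset.prod_univ_sum (fun _ => Finset.univ)
    (fun i z => pauli (p i) (x i) z * pauli (q i) z (y i))).symm

theorem pauliString_conjTranspose {n : ℕ} (p : Fin n → Fin 4) :
    (pauliString p)ᴴ = pauliString p := by
  ext x y
  have h : ∀ i, star (pauli (p i) (y i) (x i)) = pauli (p i) (x i) (y i) := fun i =>
    congrFun (congrFun (pauli_conjTranspose (p i)) (x i)) (y i)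
  simp only [pauliString, Matrix.conjTranspose_apply, Matrix.of_apply, star_prod, h]

theorem pauliString_zero (n : ℕ) : pauliString (0 : Fin n → Fin 4) = 1 := by
  ext x y
  simp [pauliString, pauli, Matrix.one_apply, Finset.prod_ite_zero, funext_iff]

/-- The `n`-qubit Pauli group: all `i^k σ_{p 0} ⊗ ⋯ ⊗ σ_{p (n-1)}`. -/
def pauliGroup (n : ℕ) : Subgroup (QU n) where
  carrier := {U | ∃ (k : ℕ) (p : Fin n → Fin 4), U.1 = Complex.I ^ k • pauliString p}
  one_mem' := ⟨0, 0, by simp [pauliString_zero]⟩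
  mul_mem' := by
    rintro U V ⟨k, p, hU⟩ ⟨l, q, hV⟩
    obtain ⟨m, r, h⟩ := pauliString_mul p q
    refine ⟨k + l + m, r, ?_⟩
    change U.1 * V.1 = _
    rw [hU, hV, Matrix.smul_mul, Matrix.mul_smul, h, smul_smul, smul_smul, pow_add, pow_add,
      mul_assoc]
  inv_mem' := by
    rintro U ⟨k, p, hU⟩
    refine ⟨3 * k, p, ?_⟩
    change star U.1 = _
    rw [hU, Matrix.star_eq_conjTranspose, Matrix.conjTranspose_smul, pauliString_conjTranspose,
      star_pow, pow_mul, Complex.I_pow_three]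
    simp

/-- The `n`-qubit Clifford group: the unitaries that normalize the Pauli group. It contains all
global phases. -/
def cliffordGroup (n : ℕ) : Subgroup (QU n) := Subgroup.normalizer (pauliGroup n : Set (QU n))

theorem pauliGroup_finite (n : ℕ) : (pauliGroup n : Set (QU n)).Finite := by
  refine Set.Finite.of_finite_image (f := Subtype.val) ?_ Subtype.val_injective.injOn
  refine (Set.finite_range fun kp : Fin 4 × (Fin n → Fin 4) =>
    Complex.I ^ (kp.1 : ℕ) • pauliString kp.2).subset ?_
  rintro _ ⟨U, ⟨k, p, hU⟩, rfl⟩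
  refine ⟨(⟨k % 4, Nat.mod_lt _ (by norm_num)⟩, p), ?_⟩
  rw [hU]
  simp [← Complex.I_pow_eq_pow_mod]

theorem cliffordGroup_isClosed (n : ℕ) : IsClosed (cliffordGroup n : Set (QU n)) := by
  have hcl : IsClosed (pauliGroup n : Set (QU n)) := (pauliGroup_finite n).isClosed
  have : (cliffordGroup n : Set (QU n)) =
      ⋂ V ∈ (pauliGroup n : Set (QU n)),
        ((fun U : QU n => U * V * U⁻¹) ⁻¹' (pauliGroup n : Set (QU n)) ∩
          (fun U : QU n => U⁻¹ * V * U) ⁻¹' (pauliGroup n : Set (QU n))) := by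
    ext U
    simp only [cliffordGroup, SetLike.mem_coe, Subgroup.mem_normalizer_iff, Set.mem_iInter,
      Set.mem_inter_iff, Set.mem_preimage]
    constructor
    · intro h V hV
      refine ⟨(h V).1 hV, (h _).2 ?_⟩
      simpa [mul_assoc] using hV
    · intro h V
      refine ⟨fun hV => (h V hV).1, fun hV => ?_⟩
      simpa [mul_assoc] using (h _ hV).2
  rw [this]
  refine isClosed_biInter fun V _ => IsClosed.inter ?_ ?_
  · exact hcl.preimage ((continuous_id.mul continuous_const).mul continuous_inv)
  · exact hcl.preimage ((continuous_inv.mul continuous_const).mul continuous_id)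

instance (n : ℕ) : CompactSpace (cliffordGroup n) :=
  isCompact_iff_compactSpace.mp (cliffordGroup_isClosed n).isCompact

/-- A uniformly random permutation operator `P`. -/
def permEnsemble (n : ℕ) : ProbabilityMeasure (QU n) :=
  ⟨((PMF.uniformOfFintype (Equiv.Perm (Bits n))).map permUnitary).toMeasure, inferInstance⟩

/-- A uniformly random binary phase operator `F`. -/
def phaseEnsemble (n : ℕ) : ProbabilityMeasure (QU n) :=
  ⟨((PMF.uniformOfFintype (Bits n → Fin 2)).map phaseUnitary).toMeasure, inferInstance⟩

/-- A uniformly random Clifford unitary `C`: the law of a Haar random element of the (compact)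
Clifford group. Modulo global phases the Clifford group is finite, and this measure gives all
its elements the same weight. -/
def cliffordEnsemble (n : ℕ) : ProbabilityMeasure (QU n) :=
  (haarProb (cliffordGroup n)).map (f := Subtype.val) measurable_subtype_coe.aemeasurable

/-- The PFC ensemble: the law of the product `P F C` of independent `P`, `F` and `C`. -/
def pfcEnsemble (n : ℕ) : ProbabilityMeasure (QU n) :=
  ⟨(permEnsemble n : Measure (QU n)) ∗ₘ (phaseEnsemble n : Measure (QU n)) ∗ₘ
    (cliffordEnsemble n : Measure (QU n)), inferInstance⟩

end PFC

end

/-!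
By duality the trace norm of a Hermitian matrix is attained on a contraction `T`, and Haar measure
absorbs the random unitary `U = PFC`, so it suffices to compare the means of the quadratic form of
`T` at `(U^{⊗t} ⊗ 1) ψ` and at `(V^{⊗t} U^{⊗t} ⊗ 1) ψ`, for one fixed unitary `V`.

The Clifford unitary `C` takes any nontrivial Pauli string to any other. The Pauli expansions of the
swap and of the collision projection of two tensor factors then show that, after `C`, two given
letters of the basis strings collide with mean weight at most `2 / d`. Projecting onto the strings
with distinct letters therefore costs `O(t / √d)`.

On such strings the signs of `F` kill all cross terms except those between reorderings of one
another, and `P` replaces the letters by a uniform embedding: what is left is the mean over strings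
`z` with distinct letters of the quadratic forms of `T` at the images of `ψ` under
`∑ τ, |z ∘ τ⟩⟨x ∘ τ|`. If `z` ran over all strings, the sum would not change under `V^{⊗t}`, which
commutes with reorderings. The strings `z` with repeated letters contribute the relative gap between
`d (d + 1) ⋯ (d + t - 1)` and `d (d - 1) ⋯ (d - t + 1)`, which is `O(t ^ 2 / d)`.
-/

noncomputable section

namespace PFC

section QuadraticForm

variable {𝕜 E α : Type*} [RCLike 𝕜] [NormedAddCommGroup E] [InnerProductSpace 𝕜 E]

theorem abs_reApplyInnerSelf_le (T : E →L[𝕜] E) (x : E) :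
    |T.reApplyInnerSelf x| ≤ ‖T‖ * ‖x‖ ^ 2 := by
  rw [T.reApplyInnerSelf_apply]
  grw [RCLike.abs_re_le_norm, norm_inner_le_norm, T.le_opNorm]
  exact (by ring : ‖T‖ * ‖x‖ * ‖x‖ = ‖T‖ * ‖x‖ ^ 2).le

theorem abs_reApplyInnerSelf_sub_le (T : E →L[𝕜] E) (x y : E) :
    |T.reApplyInnerSelf x - T.reApplyInnerSelf y| ≤ ‖T‖ * ((‖x‖ + ‖y‖) * ‖x - y‖) := by
  have hsplit : T.reApplyInnerSelf x - T.reApplyInnerSelf y =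
      RCLike.re (inner 𝕜 (T (x - y)) x) + RCLike.re (inner 𝕜 (T y) (x - y)) := by
    simp only [T.reApplyInnerSelf_apply, map_sub, inner_sub_left, inner_sub_right]
    ring
  rw [hsplit]
  grw [abs_add_le, RCLike.abs_re_le_norm, RCLike.abs_re_le_norm, norm_inner_le_norm,
    norm_inner_le_norm, T.le_opNorm, T.le_opNorm]
  exact (by ring : ‖T‖ * ‖x - y‖ * ‖x‖ + ‖T‖ * ‖y‖ * ‖x - y‖ =
    ‖T‖ * ((‖x‖ + ‖y‖) * ‖x - y‖)).le

theorem reApplyInnerSelf_sum_apply (s : Finset α) (T : α → E →L[𝕜] E) (x : E) :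
    (∑ i ∈ s, T i).reApplyInnerSelf x = ∑ i ∈ s, (T i).reApplyInnerSelf x := by
  simp only [ContinuousLinearMap.reApplyInnerSelf_apply, _root_.sum_apply,
    sum_inner, map_sum]

theorem reApplyInnerSelf_star_mul_mul [CompleteSpace E] (A T : E →L[𝕜] E) (x : E) :
    (star A * T * A).reApplyInnerSelf x = T.reApplyInnerSelf (A x) := by
  rw [ContinuousLinearMap.reApplyInnerSelf_apply, ContinuousLinearMap.reApplyInnerSelf_apply,
    ContinuousLinearMap.star_eq_adjoint, mul_assoc, mul_apply_eq_comp,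
    mul_apply_eq_comp, ContinuousLinearMap.adjoint_inner_left]

theorem reApplyInnerSelf_sum [Fintype α] (T : E →L[𝕜] E) (g : α → E) :
    T.reApplyInnerSelf (∑ a, g a) = ∑ a, ∑ b, RCLike.re (inner 𝕜 (T (g a)) (g b)) := by
  simp only [T.reApplyInnerSelf_apply, map_sum, sum_inner, inner_sum]
  exact Finset.sum_comm

theorem sum_reApplyInnerSelf_sum_smul [Fintype α] {ι : Type*} [Fintype ι] (T : E →L[𝕜] E)
    (c : ι → α → 𝕜) (g : α → E) :
    ∑ i, T.reApplyInnerSelf (∑ a, c i a • g a) =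
      ∑ a, ∑ b, RCLike.re ((∑ i, star (c i a) * c i b) * inner 𝕜 (T (g a)) (g b)) := by
  simp only [reApplyInnerSelf_sum, map_smul, inner_smul_left, inner_smul_right, Finset.sum_mul,
    map_sum, RCLike.star_def, mul_assoc, mul_left_comm (starRingEnd 𝕜 _)]
  rw [Finset.sum_comm]
  exact Finset.sum_congr rfl fun a _ => Finset.sum_comm

theorem sum_reApplyInnerSelf_sum_unitary_smul [Fintype α] [DecidableEq α] (T : E →L[𝕜] E)
    (U : Matrix.unitaryGroup α 𝕜) (g : α → E) :
    ∑ i, T.reApplyInnerSelf (∑ a, U.1 a i • g a) = ∑ a, T.reApplyInnerSelf (g a) := by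
  have hgram : ∀ a b, ∑ i, star (U.1 a i) * U.1 b i = if b = a then 1 else 0 := fun a b => by
    simpa [Matrix.mul_apply, Matrix.one_apply, mul_comm] using
      congrFun (congrFun (Matrix.mem_unitaryGroup_iff.1 U.2) b) a
  rw [sum_reApplyInnerSelf_sum_smul]
  simp only [hgram, ite_mul, one_mul, zero_mul, apply_ite RCLike.re, map_zero,
    Finset.sum_ite_eq', Finset.mem_univ, if_true, T.reApplyInnerSelf_apply]

theorem abs_reApplyInnerSelf_le_of_norm_le_one {T : E →L[𝕜] E} (hT : ‖T‖ ≤ 1) (x : E) :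
    |T.reApplyInnerSelf x| ≤ ‖x‖ ^ 2 :=
  (abs_reApplyInnerSelf_le T x).trans (mul_le_of_le_one_left (by positivity) hT)

theorem norm_star_mul_mul_le_one [CompleteSpace E] {A T : E →L[𝕜] E} (hA : A ∈ unitary (E →L[𝕜] E))
    (hT : ‖T‖ ≤ 1) : ‖star A * T * A‖ ≤ 1 := by
  rwa [CStarRing.norm_mul_mem_unitary _ hA,
    CStarRing.norm_mem_unitary_mul _ (Unitary.star_mem hA)]

end QuadraticForm

section PiKronecker

variable {κ ι 𝕜 : Type*} [Fintype κ]

/-- The Kronecker product `⨂ k, A k` of a finite family of square matrices, indexed by strings. It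
covers both the tensor powers `U^{⊗t}` and the Pauli strings. -/
def piKronecker [CommMonoid 𝕜] (A : κ → Matrix ι ι 𝕜) : Matrix (κ → ι) (κ → ι) 𝕜 :=
  Matrix.of fun a b => ∏ k, A k (a k) (b k)

theorem piKronecker_mul [CommSemiring 𝕜] [DecidableEq κ] [Fintype ι] (A B : κ → Matrix ι ι 𝕜) :
    piKronecker A * piKronecker B = piKronecker fun k => A k * B k := by
  ext x y
  simp only [piKronecker, Matrix.mul_apply, Matrix.of_apply, ← Finset.prod_mul_distrib]
  exact (Finset.prod_univ_sum (fun _ => Finset.univ) fun i z => A i (x i) z * B i z (y i)).symm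

theorem piKronecker_one [CommSemiring 𝕜] [DecidableEq ι] [DecidableEq (κ → ι)] :
    piKronecker (fun _ : κ => (1 : Matrix ι ι 𝕜)) = 1 := by
  ext x y
  simp [piKronecker, Matrix.one_apply, Finset.prod_ite_zero, funext_iff]

theorem piKronecker_conjTranspose [CommSemiring 𝕜] [StarRing 𝕜] (A : κ → Matrix ι ι 𝕜) :
    (piKronecker A)ᴴ = piKronecker fun k => (A k)ᴴ := by
  ext x y
  simp [piKronecker, Matrix.conjTranspose_apply]

theorem piKronecker_smul {S : Type*} [CommMonoid S] [CommMonoid 𝕜] [MulAction S 𝕜]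
    [IsScalarTower S 𝕜 𝕜] [SMulCommClass S 𝕜 𝕜] (s : κ → S) (A : κ → Matrix ι ι 𝕜) :
    piKronecker (fun k => s k • A k) = (∏ k, s k) • piKronecker A := by
  ext x y
  exact Finset.prod_smul _ _ _

theorem piKronecker_mem_unitaryGroup [CommRing 𝕜] [StarRing 𝕜] [DecidableEq κ] [Fintype ι]
    [DecidableEq ι] {A : κ → Matrix ι ι 𝕜} (hA : ∀ k, A k ∈ Matrix.unitaryGroup ι 𝕜) :
    piKronecker A ∈ Matrix.unitaryGroup (κ → ι) 𝕜 := by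
  rw [Matrix.mem_unitaryGroup_iff, Matrix.star_eq_conjTranspose, piKronecker_conjTranspose,
    piKronecker_mul, ← piKronecker_one]
  exact congrArg piKronecker (funext fun k => Matrix.mem_unitaryGroup_iff.1 (hA k))

end PiKronecker

section Ampliation

open scoped Kronecker

variable {κ R : Type*} [Fintype κ] [DecidableEq κ] [Fintype R] [DecidableEq R]

/-- `M ↦ M ⊗ 1`, as a representation of the `κ × κ` matrices on `ℂ^κ ⊗ ℂ^R`. -/
def ampliation (κ R : Type*) [Fintype κ] [DecidableEq κ] [Fintype R] [DecidableEq R] :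
    Matrix κ κ ℂ →⋆ₐ[ℂ] (EuclideanSpace ℂ (κ × R) →L[ℂ] EuclideanSpace ℂ (κ × R)) where
  toFun M := Matrix.toEuclideanCLM (𝕜 := ℂ) (M ⊗ₖ (1 : Matrix R R ℂ))
  map_one' := by rw [Matrix.one_kronecker_one, map_one]
  map_mul' M N := by rw [← map_mul, ← Matrix.mul_kronecker_mul, one_mul]
  map_zero' := by rw [Matrix.zero_kronecker, map_zero]
  map_add' M N := by rw [Matrix.add_kronecker, map_add]
  commutes' c := by
    rw [Algebra.algebraMap_eq_smul_one, Matrix.smul_kronecker, Matrix.one_kronecker_one, map_smul,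
      map_one, Algebra.algebraMap_eq_smul_one]
  map_star' M := by
    rw [← map_star, Matrix.star_eq_conjTranspose, Matrix.star_eq_conjTranspose,
      Matrix.conjTranspose_kronecker, Matrix.conjTranspose_one]

theorem ampliation_apply (M : Matrix κ κ ℂ) (φ : EuclideanSpace ℂ (κ × R)) (p : κ × R) :
    ampliation κ R M φ p = ∑ b, M p.1 b * φ (b, p.2) := by
  change ((M ⊗ₖ (1 : Matrix R R ℂ)) *ᵥ φ.ofLp) p = _
  simp [Matrix.mulVec, dotProduct, Fintype.sum_prod_type, Matrix.one_apply]

theorem ampliation_diagonal_apply (w : κ → ℂ) (φ : EuclideanSpace ℂ (κ × R)) (p : κ × R) :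
    ampliation κ R (Matrix.diagonal w) φ p = w p.1 * φ p := by
  simp [ampliation_apply, Matrix.diagonal_apply]

end Ampliation

section TensorAct

variable {ι R : Type*} [Fintype ι] [DecidableEq ι] [Fintype R] [DecidableEq R] {t : ℕ}

theorem tensorPow_mem_unitaryGroup (t : ℕ) (U : Matrix.unitaryGroup ι ℂ) :
    tensorPow t U.1 ∈ Matrix.unitaryGroup (Fin t → ι) ℂ :=
  piKronecker_mem_unitaryGroup fun _ => U.2

/-- The representation `U ↦ U^{⊗t} ⊗ 1` of the unitary group on `(ℂ^ι)^{⊗t} ⊗ ℂ^R`. -/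
def tensorAct (t : ℕ) (R : Type*) [Fintype R] [DecidableEq R] : Matrix.unitaryGroup ι ℂ →*
    (EuclideanSpace ℂ ((Fin t → ι) × R) →L[ℂ] EuclideanSpace ℂ ((Fin t → ι) × R)) where
  toFun U := ampliation _ R (tensorPow t U.1)
  map_one' := (congrArg _ piKronecker_one).trans (map_one _)
  map_mul' U V :=
    (congrArg _ (piKronecker_mul (fun _ => U.1) fun _ => V.1).symm).trans (map_mul _ _ _)

theorem tensorAct_apply (U : Matrix.unitaryGroup ι ℂ) (φ : EuclideanSpace ℂ ((Fin t → ι) × R))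
    (p : (Fin t → ι) × R) :
    tensorAct t R U φ p = ∑ b, tensorPow t U.1 p.1 b * φ (b, p.2) :=
  ampliation_apply _ φ p

theorem tensorAct_ampliation_apply (U : Matrix.unitaryGroup ι ℂ)
    (M : Matrix (Fin t → ι) (Fin t → ι) ℂ) (φ : EuclideanSpace ℂ ((Fin t → ι) × R)) :
    tensorAct t R U (ampliation _ R M φ) = ampliation _ R (tensorPow t U.1 * M) φ :=
  (DFunLike.congr_fun (map_mul (ampliation (Fin t → ι) R) (tensorPow t U.1) M) φ).symm

theorem tensorAct_mem_unitary (U : Matrix.unitaryGroup ι ℂ) : tensorAct t R U ∈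
    unitary (EuclideanSpace ℂ ((Fin t → ι) × R) →L[ℂ] EuclideanSpace ℂ ((Fin t → ι) × R)) :=
  Unitary.map_mem (ampliation _ R) (tensorPow_mem_unitaryGroup t U)

theorem norm_tensorAct_apply (U : Matrix.unitaryGroup ι ℂ)
    (φ : EuclideanSpace ℂ ((Fin t → ι) × R)) : ‖tensorAct t R U φ‖ = ‖φ‖ :=
  ContinuousLinearMap.norm_map_of_mem_unitary (tensorAct_mem_unitary U) φ

theorem continuous_tensorAct_apply (φ : EuclideanSpace ℂ ((Fin t → ι) × R)) :
    Continuous fun U : Matrix.unitaryGroup ι ℂ => tensorAct t R U φ := by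
  have hentry : ∀ p, Continuous fun U : Matrix.unitaryGroup ι ℂ => tensorAct t R U φ p := by
    intro p
    simp only [tensorAct_apply, tensorPow, Matrix.of_apply]
    exact continuous_finsetSum _ fun b _ => (continuous_finsetProd _ fun k _ =>
      continuous_subtype_val.matrix_elem (p.1 k) (b k)).mul continuous_const
  exact (PiLp.continuous_toLp 2 _).comp (continuous_pi hentry)

end TensorAct

section TraceNorm

variable {κ : Type*} [Fintype κ] [DecidableEq κ]

-- The unitary is the sign of `D`, with the convention `sign 0 = 1`.
theorem exists_unitary_traceNorm_eq {D : Matrix κ κ ℂ} (hD : D.IsHermitian) :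
    ∃ W ∈ Matrix.unitaryGroup κ ℂ, traceNorm D = (W * D).trace.re := by
  let s : ℝ → ℝ := fun x => if 0 ≤ x then 1 else -1
  have hs : ∀ x, s x * s x = 1 := fun x => by simp only [s]; split_ifs <;> norm_num
  have hs_mul : ∀ x, s x * x = |x| := fun x => by
    simp only [s]
    split_ifs with h
    · rw [abs_of_nonneg h, one_mul]
    · rw [abs_of_neg (not_le.1 h), neg_one_mul]
  have hc : ∀ f : ℝ → ℝ, ContinuousOn f (spectrum ℝ D) := fun f =>
    (Matrix.finite_real_spectrum (A := D)).continuousOn f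
  have hsa : IsSelfAdjoint D := hD
  refine ⟨cfc s D, ?_, ?_⟩
  · rw [Matrix.mem_unitaryGroup_iff, (cfc_predicate s D : IsSelfAdjoint _).star_eq,
      ← cfc_mul s s D (hc _) (hc _), funext hs, cfc_const_one ℝ D]
  · have hsq : Dᴴ * D = cfc (fun x : ℝ => x * x) D := by
      rw [cfc_mul (fun x => x) (fun x => x) D (hc _) (hc _), cfc_id' ℝ D, hD.eq]
    have habs : cfc s D * D = cfc (fun x : ℝ => |x|) D := by
      rw [← funext hs_mul, cfc_mul s (fun x => x) D (hc _) (hc _), cfc_id' ℝ D]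
    rw [traceNorm, hsq, habs, ← cfc_comp' Real.sqrt (fun x => x * x) D
      Real.continuous_sqrt.continuousOn (hc _) hsa]
    simp only [Real.sqrt_mul_self_eq_abs]

theorem norm_le_one_of_mem_unitary {E : Type*} [NormedAddCommGroup E] [InnerProductSpace ℂ E]
    [CompleteSpace E] {T : E →L[ℂ] E} (hT : T ∈ unitary (E →L[ℂ] E)) : ‖T‖ ≤ 1 :=
  T.opNorm_le_bound zero_le_one fun x => by
    rw [ContinuousLinearMap.norm_map_of_mem_unitary hT, one_mul]

theorem reApplyInnerSelf_toEuclideanCLM (W : Matrix κ κ ℂ) (φ : EuclideanSpace ℂ κ) :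
    (Matrix.toEuclideanCLM (𝕜 := ℂ) W).reApplyInnerSelf φ = (W * proj φ).trace.re := by
  rw [ContinuousLinearMap.reApplyInnerSelf_apply, ← inner_conj_symm, RCLike.conj_re,
    PiLp.inner_apply]
  simp [Matrix.trace, Matrix.mul_apply, proj, Matrix.mulVec, dotProduct, Finset.sum_mul,
    mul_assoc]

end TraceNorm

section Twirl

theorem integrable_of_continuous {X E : Type*} [TopologicalSpace X] [CompactSpace X]
    [MeasurableSpace X] [OpensMeasurableSpace X] [NormedAddCommGroup E] [SecondCountableTopology E]
    {f : X → E} (hf : Continuous f) (ν : Measure X) [IsFiniteMeasure ν] : Integrable f ν := by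
  borelize E
  exact hf.integrable_of_hasCompactSupport (HasCompactSupport.of_compactSpace _)

theorem proj_isHermitian {κ : Type*} (ψ : EuclideanSpace ℂ κ) : (proj ψ).IsHermitian := by
  ext a b
  simp [proj, mul_comm]

theorem isHermitian_tensorId {κ μ R : Type*} {M : Superop κ μ} (hM : ∀ X, M Xᴴ = (M X)ᴴ)
    {X : Matrix (κ × R) (κ × R) ℂ} (hX : X.IsHermitian) : (M.tensorId R X).IsHermitian := by
  ext p q
  have hblock : (Matrix.of fun a b => X (a, q.2) (b, p.2)) =
      (Matrix.of fun a b => X (a, p.2) (b, q.2))ᴴ := by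
    ext a b
    exact (hX.apply _ _).symm
  change star (M _ _ _) = M _ _ _
  rw [hblock, hM, Matrix.conjTranspose_apply, star_star]

variable {ι R : Type*} [Fintype ι] [DecidableEq ι] [Fintype R] [DecidableEq R] {t : ℕ}

theorem twirl_conjTranspose (ν : ProbabilityMeasure (Matrix.unitaryGroup ι ℂ))
    (X : Matrix (Fin t → ι) (Fin t → ι) ℂ) : twirl ν t Xᴴ = (twirl ν t X)ᴴ := by
  ext a b
  change ∫ U : Matrix.unitaryGroup ι ℂ, _ ∂(ν : Measure _) =
    star (∫ U : Matrix.unitaryGroup ι ℂ, _ ∂(ν : Measure _))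
  refine Eq.trans (congrArg _ (funext fun U => ?_)) integral_conj
  have hconj : tensorPow t U.1 * Xᴴ * (tensorPow t U.1)ᴴ =
      (tensorPow t U.1 * X * (tensorPow t U.1)ᴴ)ᴴ := by
    rw [Matrix.conjTranspose_mul, Matrix.conjTranspose_mul, Matrix.conjTranspose_conjTranspose,
      Matrix.mul_assoc]
  exact congrFun (congrFun hconj a) b

theorem twirl_tensorId_proj_apply (ν : ProbabilityMeasure (Matrix.unitaryGroup ι ℂ))
    (ψ : EuclideanSpace ℂ ((Fin t → ι) × R)) (p q : (Fin t → ι) × R) :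
    (twirl ν t).tensorId R (proj ψ) p q =
      ∫ U : Matrix.unitaryGroup ι ℂ, proj (tensorAct t R U ψ) p q ∂(ν : Measure _) := by
  change ∫ U : Matrix.unitaryGroup ι ℂ, _ ∂(ν : Measure _) = _
  congr 1
  funext U
  simp only [Matrix.mul_apply, Matrix.of_apply, proj, tensorAct_apply, Matrix.conjTranspose_apply,
    star_sum, star_mul', Finset.sum_mul, Finset.mul_sum]
  exact Finset.sum_congr rfl fun a _ => Finset.sum_congr rfl fun b _ => by ring

theorem trace_mul_twirl_tensorId_proj_re (ν : ProbabilityMeasure (Matrix.unitaryGroup ι ℂ))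
    (W : Matrix ((Fin t → ι) × R) ((Fin t → ι) × R) ℂ) (ψ : EuclideanSpace ℂ ((Fin t → ι) × R)) :
    (W * (twirl ν t).tensorId R (proj ψ)).trace.re =
      ∫ U : Matrix.unitaryGroup ι ℂ, (Matrix.toEuclideanCLM (𝕜 := ℂ) W).reApplyInnerSelf
        (tensorAct t R U ψ) ∂(ν : Measure _) := by
  have hint : ∀ p q, Integrable (fun U : Matrix.unitaryGroup ι ℂ =>
      W p q * proj (tensorAct t R U ψ) q p) (ν : Measure _) := fun p q => by
    have hc : Continuous fun φ : EuclideanSpace ℂ ((Fin t → ι) × R) => W p q * proj φ q p := by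
      simp only [proj, Matrix.of_apply]
      fun_prop
    exact integrable_of_continuous (hc.comp (continuous_tensorAct_apply ψ)) _
  have hint_sum := fun p => integrable_finsetSum Finset.univ fun q _ => hint p q
  have htrace : (W * (twirl ν t).tensorId R (proj ψ)).trace =
      ∫ U : Matrix.unitaryGroup ι ℂ, (W * proj (tensorAct t R U ψ)).trace ∂(ν : Measure _) := by
    simp only [Matrix.trace, Matrix.diag_apply, Matrix.mul_apply, twirl_tensorId_proj_apply,
      ← integral_const_mul]
    rw [integral_finsetSum _ fun p _ => hint_sum p]
    exact Finset.sum_congr rfl fun p _ => (integral_finsetSum _ fun q _ => hint p q).symm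
  simp only [reApplyInnerSelf_toEuclideanCLM, htrace]
  exact (integral_re (integrable_finsetSum _ fun p _ => hint_sum p)).symm

theorem continuous_reApplyInnerSelf_tensorAct_apply
    (T : EuclideanSpace ℂ ((Fin t → ι) × R) →L[ℂ] EuclideanSpace ℂ ((Fin t → ι) × R))
    (ψ : EuclideanSpace ℂ ((Fin t → ι) × R)) :
    Continuous fun U : Matrix.unitaryGroup ι ℂ => T.reApplyInnerSelf (tensorAct t R U ψ) :=
  T.reApplyInnerSelf_continuous.comp (continuous_tensorAct_apply ψ)

theorem traceNorm_twirl_sub_le {ν μ : ProbabilityMeasure (Matrix.unitaryGroup ι ℂ)}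
    {ψ : EuclideanSpace ℂ ((Fin t → ι) × R)} {ε : ℝ}
    (h : ∀ T : EuclideanSpace ℂ ((Fin t → ι) × R) →L[ℂ] EuclideanSpace ℂ ((Fin t → ι) × R),
      ‖T‖ ≤ 1 → ∫ U, T.reApplyInnerSelf (tensorAct t R U ψ) ∂(ν : Measure _) -
        ∫ U, T.reApplyInnerSelf (tensorAct t R U ψ) ∂(μ : Measure _) ≤ ε) :
    traceNorm ((twirl ν t).tensorId R (proj ψ) - (twirl μ t).tensorId R (proj ψ)) ≤ ε := by
  have hherm : ∀ ρ : ProbabilityMeasure (Matrix.unitaryGroup ι ℂ),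
      ((twirl ρ t).tensorId R (proj ψ)).IsHermitian := fun ρ =>
    isHermitian_tensorId (twirl_conjTranspose ρ) (proj_isHermitian ψ)
  obtain ⟨W, hW, hD⟩ := exists_unitary_traceNorm_eq ((hherm ν).sub (hherm μ))
  rw [hD, Matrix.mul_sub, Matrix.trace_sub, Complex.sub_re, trace_mul_twirl_tensorId_proj_re,
    trace_mul_twirl_tensorId_proj_re]
  exact h _ (norm_le_one_of_mem_unitary (Unitary.map_mem _ hW))

end Twirl

section Haar

variable {G : Type*} [Group G] [TopologicalSpace G] [IsTopologicalGroup G] [CompactSpace G]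
  [MeasurableSpace G] [BorelSpace G]

instance : (haarProb G : Measure G).IsMulLeftInvariant :=
  inferInstanceAs (Measure.haarMeasure (⊤ : TopologicalSpace.PositiveCompacts G)).IsMulLeftInvariant

instance : (haarProb G : Measure G).IsMulRightInvariant := by
  refine ⟨fun g => ?_⟩
  have : (haarProb G : Measure G).IsHaarMeasure :=
    inferInstanceAs (Measure.haarMeasure (⊤ : TopologicalSpace.PositiveCompacts G)).IsHaarMeasure
  have : IsProbabilityMeasure ((haarProb G : Measure G).map (· * g)) :=
    Measure.isProbabilityMeasure_map (by fun_prop)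
  exact Measure.isHaarMeasure_eq_of_isProbabilityMeasure _ _

theorem integral_integral_mul_haarProb {f : G → ℝ} (hf : Continuous f) (ν : Measure G)
    [IsProbabilityMeasure ν] :
    ∫ V, ∫ U, f (V * U) ∂ν ∂(haarProb G : Measure G) = ∫ V, f V ∂(haarProb G : Measure G) := by
  rw [integral_integral_swap_of_hasCompactSupport (f := fun V U => f (V * U))
    (hf.comp continuous_mul) (HasCompactSupport.of_compactSpace _)]
  simp [integral_mul_right_eq_self]

theorem continuous_integral_mul_left [FirstCountableTopology G] {f : G → ℝ} (hf : Continuous f)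
    (ν : Measure G) [IsFiniteMeasure ν] : Continuous fun V => ∫ U, f (V * U) ∂ν := by
  simpa using continuous_parametric_integral_of_continuous (μ := ν)
    (f := fun V U => f (V * U)) (hf.comp continuous_mul) isCompact_univ

theorem integral_sub_integral_haarProb_le [FirstCountableTopology G] {f : G → ℝ}
    (hf : Continuous f) (ν : Measure G) [IsProbabilityMeasure ν] {ε : ℝ}
    (h : ∀ V, ∫ U, f U ∂ν - ∫ U, f (V * U) ∂ν ≤ ε) :
    ∫ U, f U ∂ν - ∫ V, f V ∂(haarProb G : Measure G) ≤ ε := by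
  have hi := integrable_of_continuous (continuous_integral_mul_left hf ν)
    (haarProb G : Measure G)
  calc ∫ U, f U ∂ν - ∫ V, f V ∂(haarProb G : Measure G)
      = ∫ V, (∫ U, f U ∂ν - ∫ U, f (V * U) ∂ν) ∂(haarProb G : Measure G) := by
        rw [integral_sub (integrable_const _) hi, integral_integral_mul_haarProb hf ν]
        simp
    _ ≤ ∫ _, ε ∂(haarProb G : Measure G) :=
        integral_mono ((integrable_const _).sub hi) (integrable_const _) h
    _ = ε := by simp

end Haar

section DesignCriterion

variable {ι : Type*} [Fintype ι] [DecidableEq ι] {t : ℕ}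

theorem isDiamondApproxDesign_of_mul_left {ν : ProbabilityMeasure (Matrix.unitaryGroup ι ℂ)} {ε : ℝ}
    (h : ∀ ψ : EuclideanSpace ℂ ((Fin t → ι) × (Fin t → ι)), ‖ψ‖ = 1 →
      ∀ T : EuclideanSpace ℂ ((Fin t → ι) × (Fin t → ι)) →L[ℂ]
        EuclideanSpace ℂ ((Fin t → ι) × (Fin t → ι)), ‖T‖ ≤ 1 → ∀ V : Matrix.unitaryGroup ι ℂ,
      ∫ U, T.reApplyInnerSelf (tensorAct t _ U ψ) ∂(ν : Measure _) -
        ∫ U, T.reApplyInnerSelf (tensorAct t _ (V * U) ψ) ∂(ν : Measure _) ≤ ε) :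
    IsDiamondApproxDesign ν ε t :=
  iSup_le fun ψ => EReal.coe_le_coe_iff.2 <| traceNorm_twirl_sub_le fun T hT =>
    integral_sub_integral_haarProb_le (continuous_reApplyInnerSelf_tensorAct_apply T ψ.1) _
      (h ψ.1 ψ.2 T hT)

end DesignCriterion

section Expectation

open scoped BigOperators

variable {X α : Type*} [MeasurableSpace X] [Fintype α]

theorem integral_expect {μ : Measure X} {f : α → X → ℝ} (hf : ∀ a, Integrable (f a) μ) :
    ∫ x, 𝔼 a, f a x ∂μ = 𝔼 a, ∫ x, f a x ∂μ := by
  simp only [Fintype.expect_eq_sum_div_card]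
  rw [integral_div, integral_finsetSum _ fun a _ => hf a]

theorem integral_map_uniformOfFintype [Nonempty α] [TopologicalSpace X] [OpensMeasurableSpace X]
    {f : X → ℝ} (hf : Continuous f) (g : α → X) :
    ∫ x, f x ∂((PMF.uniformOfFintype α).map g).toMeasure = 𝔼 a, f (g a) := by
  let _ : MeasurableSpace α := ⊤
  rw [← PMF.toMeasure_map _ _ measurable_from_top,
    integral_map measurable_from_top.aemeasurable hf.aestronglyMeasurable, PMF.integral_eq_sum,
    Fintype.expect_eq_sum_div_card, Finset.sum_div]
  simp [div_eq_inv_mul]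

theorem expect_smul_eq_expect {G : Type*} [Group G] [Fintype G] [MulAction G α]
    [MulAction.IsPretransitive G α] (h : α → ℝ) (x : α) : 𝔼 g : G, h (g • x) = 𝔼 y, h y := by
  have hconst : ∀ y, 𝔼 g : G, h (g • y) = 𝔼 g : G, h (g • x) := fun y => by
    obtain ⟨k, rfl⟩ := MulAction.exists_smul_eq G x y
    exact Fintype.expect_equiv (Equiv.mulRight k) _ _ fun g => by simp [mul_smul]
  have hinv : ∀ g : G, 𝔼 y, h (g • y) = 𝔼 y, h y := fun g =>
    Fintype.expect_equiv (MulAction.toPerm g) _ _ fun _ => rfl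
  have : Nonempty α := ⟨x⟩
  calc 𝔼 g : G, h (g • x) = 𝔼 y, 𝔼 g : G, h (g • y) := by simp only [hconst, Fintype.expect_const]
    _ = 𝔼 g : G, 𝔼 y, h (g • y) := Finset.expect_comm _ _ _
    _ = 𝔼 y, h y := by simp only [hinv, Fintype.expect_const]

end Expectation

section Ensembles

open scoped BigOperators

variable {n : ℕ}

theorem integral_pfcEnsemble {f : QU n → ℝ} (hf : Continuous f) :
    ∫ U, f U ∂(pfcEnsemble n : Measure (QU n)) =
      ∫ C, 𝔼 π, 𝔼 g, f (permUnitary π * (phaseUnitary g * C))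
        ∂(cliffordEnsemble n : Measure (QU n)) := by
  have hint : ∀ h : QU n → ℝ, Continuous h →
      Integrable h (cliffordEnsemble n : Measure (QU n)) :=
    fun h hh => integrable_of_continuous hh _
  have hP : ∫ U, f U ∂(pfcEnsemble n : Measure (QU n)) = 𝔼 π, ∫ U, f (permUnitary π * U)
      ∂((phaseEnsemble n : Measure (QU n)) ∗ₘ (cliffordEnsemble n : Measure (QU n))) :=
    (integral_mconv (integrable_of_continuous hf (pfcEnsemble n : Measure (QU n)))).trans
      (integral_map_uniformOfFintype (continuous_integral_mul_left hf _) _)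
  have hF : ∀ π, ∫ U, f (permUnitary π * U)
      ∂((phaseEnsemble n : Measure (QU n)) ∗ₘ (cliffordEnsemble n : Measure (QU n))) =
      𝔼 g, ∫ C, f (permUnitary π * (phaseUnitary g * C))
        ∂(cliffordEnsemble n : Measure (QU n)) := fun π => by
    have hfπ : Continuous fun U => f (permUnitary π * U) := by fun_prop
    exact (integral_mconv (integrable_of_continuous hfπ _)).trans
      (integral_map_uniformOfFintype (continuous_integral_mul_left hfπ _) _)
  rw [hP, integral_expect fun π => hint _ ?_]
  · refine Finset.expect_congr rfl fun π _ => ?_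
    rw [hF, integral_expect fun g => hint _ (by fun_prop)]
  · simp only [Fintype.expect_eq_sum_div_card]
    fun_prop

theorem integral_cliffordEnsemble_mul_left {V : QU n} (hV : V ∈ cliffordGroup n) {f : QU n → ℝ}
    (hf : Continuous f) : ∫ U, f (V * U) ∂(cliffordEnsemble n : Measure (QU n)) =
      ∫ U, f U ∂(cliffordEnsemble n : Measure (QU n)) := by
  have hmap : ∀ h : QU n → ℝ, Continuous h → ∫ U, h U ∂(cliffordEnsemble n : Measure (QU n)) =
      ∫ U : cliffordGroup n, h U.1 ∂(haarProb (cliffordGroup n) : Measure (cliffordGroup n)) :=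
    fun h hh => integral_map measurable_subtype_coe.aemeasurable hh.aestronglyMeasurable
  rw [hmap f hf, hmap (fun U => f (V * U)) (by fun_prop)]
  exact integral_mul_left_eq_self (μ := (haarProb (cliffordGroup n) : Measure (cliffordGroup n)))
    (fun U : cliffordGroup n => f U.1) ⟨V, hV⟩

end Ensembles

section Counting

theorem sum_sum_comp_perm_le {κ ι : Type*} [Fintype κ] [DecidableEq κ] [Fintype ι] [Fintype (κ ↪ ι)]
    {f : (κ → ι) → ℝ}
    (hf : ∀ a, 0 ≤ f a) :
    ∑ x : κ ↪ ι, ∑ τ : Equiv.Perm κ, f (x ∘ τ) ≤ (Fintype.card κ).factorial * ∑ a, f a := by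
  have hperm : ∀ τ : Equiv.Perm κ, ∑ x : κ ↪ ι, f (x ∘ τ) ≤ ∑ a, f a := fun τ => by
    let reorder : (κ ↪ ι) ↪ (κ → ι) :=
      ⟨fun x => x ∘ τ, fun _ _ h => DFunLike.coe_injective (τ.surjective.injective_comp_right h)⟩
    exact (Finset.sum_map Finset.univ reorder f).symm.trans_le (Finset.sum_le_univ_sum_of_nonneg hf)
  rw [Finset.sum_comm]
  grw [Finset.sum_le_sum fun τ _ => hperm τ]
  simp [Fintype.card_perm]

variable {ι : Type*} [DecidableEq ι] {t : ℕ}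

theorem card_comp_perm_eq_cons [Finite ι] (v : ι) (z : Fin t → ι) :
    Fintype.card {τ : Equiv.Perm (Fin (t + 1)) //
        (Fin.cons v z : Fin (t + 1) → ι) ∘ τ = Fin.cons v z} =
      (Fintype.card {k // z k = v} + 1) * Fintype.card {τ : Equiv.Perm (Fin t) // z ∘ τ = z} := by
  cases nonempty_fintype ι
  have hfiber : ∀ w, Fintype.card {k // (Fin.cons v z : Fin (t + 1) → ι) k = w} =
      (if v = w then 1 else 0) + Fintype.card {k // z k = w} := fun w => by
    simp only [Fintype.card_subtype, Finset.card_filter, Fin.sum_univ_succ, Fin.cons_zero,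
      Fin.cons_succ]
  rw [DomMulAct.stabilizer_card, DomMulAct.stabilizer_card,
    ← Finset.mul_prod_erase _ _ (Finset.mem_univ v),
    ← Finset.mul_prod_erase Finset.univ (fun i => (Fintype.card {k // z k = i}).factorial)
      (Finset.mem_univ v), hfiber, if_pos rfl, add_comm 1, Nat.factorial_succ, mul_assoc]
  congr 2
  refine Finset.prod_congr rfl fun w hw => ?_
  rw [hfiber, if_neg (Finset.ne_of_mem_erase hw).symm, zero_add]

theorem card_comp_perm_eq_of_injective {κ : Type*} [Fintype κ] [DecidableEq κ] {z : κ → ι}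
    (hz : z.Injective) : Fintype.card {τ : Equiv.Perm κ // z ∘ τ = z} = 1 :=
  Fintype.card_eq_one_iff.2 ⟨⟨1, rfl⟩, fun τ => Subtype.ext <| Equiv.ext fun k =>
    hz (congrFun τ.2 k)⟩

theorem card_comp_perm_eq_le {κ : Type*} [Fintype κ] [DecidableEq κ] (a z : κ → ι) :
    Fintype.card {τ : Equiv.Perm κ // z ∘ τ = a} ≤
      Fintype.card {τ : Equiv.Perm κ // z ∘ τ = z} := by
  by_cases h : ∃ σ : Equiv.Perm κ, z ∘ σ = a
  · obtain ⟨σ, rfl⟩ := h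
    exact (Fintype.card_congr ((Equiv.mulRight σ⁻¹).subtypeEquiv fun τ =>
      (Equiv.comp_symm_eq σ z (z ∘ τ)).symm)).le
  · have : IsEmpty {τ : Equiv.Perm κ // z ∘ τ = a} := ⟨fun τ => h ⟨τ.1, τ.2⟩⟩
    simp

variable [Fintype ι]

variable (ι t) in
theorem sum_card_comp_perm_eq :
    ∑ z : Fin t → ι, Fintype.card {τ : Equiv.Perm (Fin t) // z ∘ τ = z} =
      (Fintype.card ι).ascFactorial t := by
  induction t with
  | zero =>
    rw [Fintype.sum_unique, Nat.ascFactorial_zero, Fintype.card_eq_one_iff]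
    exact ⟨⟨1, rfl⟩, fun _ => Subsingleton.elim _ _⟩
  | succ t ih =>
    have hfibers : ∀ z : Fin t → ι, ∑ v, Fintype.card {k // z k = v} = t := fun z => by
      rw [← Fintype.card_sigma, Fintype.card_congr (Equiv.sigmaFiberEquiv z), Fintype.card_fin]
    rw [← Equiv.sum_comp (Fin.consEquiv fun _ => ι), Fintype.sum_prod_type, Finset.sum_comm,
      Nat.ascFactorial_succ, ← ih, Finset.mul_sum]
    refine Finset.sum_congr rfl fun z _ => ?_
    refine (Finset.sum_congr rfl fun v _ => card_comp_perm_eq_cons v z).trans ?_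
    rw [← Finset.sum_mul, Finset.sum_add_distrib, hfibers, Finset.sum_const, Finset.card_univ,
      smul_eq_mul, mul_one, add_comm t]

variable (ι t) in
theorem sum_card_comp_perm_eq_not_injective :
    (∑ z : Fin t → ι with ¬ z.Injective,
      (Fintype.card {τ : Equiv.Perm (Fin t) // z ∘ τ = z} : ℝ)) =
      (Fintype.card ι).ascFactorial t - (Fintype.card ι).descFactorial t := by
  have hinj : ∑ z : Fin t → ι with z.Injective,
      Fintype.card {τ : Equiv.Perm (Fin t) // z ∘ τ = z} = (Fintype.card ι).descFactorial t := by
    rw [Finset.sum_congr rfl fun z hz =>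
        card_comp_perm_eq_of_injective (Finset.mem_filter.1 hz).2, ← Finset.card_eq_sum_ones,
      ← Fintype.card_subtype, Fintype.card_congr (Equiv.subtypeInjectiveEquivEmbedding (Fin t) ι),
      Fintype.card_embedding_eq, Fintype.card_fin]
  rw [eq_sub_iff_add_eq', ← sum_card_comp_perm_eq ι t, ← hinj]
  exact_mod_cast Finset.sum_filter_add_sum_filter_not Finset.univ
    (fun z : Fin t → ι => z.Injective) _

end Counting

section Phases

theorem exists_perm_of_range_subset {κ ι : Type*} [Finite κ] {a b : κ ↪ ι}
    (h : Set.range b ⊆ Set.range a) : ∃ τ : Equiv.Perm κ, τ.toEmbedding.trans a = b := by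
  choose g hg using fun k => h ⟨k, rfl⟩
  have hginj : g.Injective := fun i j hij => b.injective (by rw [← hg i, ← hg j, hij])
  exact ⟨Equiv.ofBijective g (Finite.injective_iff_bijective.1 hginj), DFunLike.ext _ _ hg⟩

variable {κ ι : Type*} [Fintype κ]

/-- The phase `(-1)^(∑ k, f (a k))` that the binary phase operator of `f` gives to the basis
string `a`. -/
def phaseSign (f : ι → Fin 2) (a : κ → ι) : ℂ := ∏ k, (-1 : ℂ) ^ (f (a k) : ℕ)

theorem phaseSign_mul_self (f : ι → Fin 2) (a : κ → ι) : phaseSign f a * phaseSign f a = 1 := by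
  rw [phaseSign, ← Finset.prod_mul_distrib]
  exact Finset.prod_eq_one fun k _ => by rw [← mul_pow]; simp

theorem star_phaseSign (f : ι → Fin 2) (a : κ → ι) : star (phaseSign f a) = phaseSign f a := by
  simp [phaseSign]

theorem phaseSign_comp_perm (f : ι → Fin 2) (a : κ → ι) (τ : Equiv.Perm κ) :
    phaseSign f (a ∘ τ) = phaseSign f a :=
  Equiv.prod_comp τ fun k => (-1 : ℂ) ^ (f (a k) : ℕ)

variable [DecidableEq ι]

theorem phaseSign_add_single {a : κ → ι} (ha : a.Injective) (f : ι → Fin 2) (k : κ) :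
    phaseSign (f + Pi.single (a k) 1) a = -phaseSign f a := by
  have hflip : ∀ s : Fin 2, (-1 : ℂ) ^ ((s + 1 : Fin 2) : ℕ) = -(-1) ^ (s : ℕ) := fun s => by
    fin_cases s <;> simp
  classical
  unfold phaseSign
  rw [← Finset.mul_prod_erase _ _ (Finset.mem_univ k),
    ← Finset.mul_prod_erase _ (fun k => (-1 : ℂ) ^ (f (a k) : ℕ)) (Finset.mem_univ k),
    Pi.add_apply, Pi.single_eq_same, hflip, neg_mul]
  congr 2
  refine Finset.prod_congr rfl fun j hj => ?_
  rw [Pi.add_apply, Pi.single_eq_of_ne (ha.ne (Finset.ne_of_mem_erase hj)), add_zero]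

theorem phaseSign_add_single_of_notMem_range {b : κ → ι} {i : ι} (hi : i ∉ Set.range b)
    (f : ι → Fin 2) : phaseSign (f + Pi.single i 1) b = phaseSign f b :=
  Finset.prod_congr rfl fun j _ => by
    rw [Pi.add_apply, Pi.single_eq_of_ne fun e => hi ⟨j, e⟩, add_zero]

variable [Fintype ι]

theorem sum_phaseSign_mul_eq_zero {a b : κ → ι} (ha : a.Injective) {k : κ}
    (hk : a k ∉ Set.range b) : ∑ f : ι → Fin 2, phaseSign f a * phaseSign f b = 0 := by
  have hflip := Equiv.sum_comp (Equiv.addRight (Pi.single (a k) 1 : ι → Fin 2))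
    fun f => phaseSign f a * phaseSign f b
  simp only [Equiv.coe_addRight, phaseSign_add_single ha, phaseSign_add_single_of_notMem_range hk,
    neg_mul, Finset.sum_neg_distrib] at hflip
  exact self_eq_neg.1 hflip.symm

theorem sum_phaseSign_mul [DecidableEq κ] (a b : κ ↪ ι) :
    ∑ f : ι → Fin 2, phaseSign f a * phaseSign f b =
      2 ^ Fintype.card ι * ∑ τ : Equiv.Perm κ, if τ.toEmbedding.trans a = b then 1 else 0 := by
  by_cases h : ∃ τ : Equiv.Perm κ, τ.toEmbedding.trans a = b
  · obtain ⟨τ, rfl⟩ := h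
    have huniq : ∀ σ : Equiv.Perm κ,
        σ.toEmbedding.trans a = τ.toEmbedding.trans a ↔ σ = τ := fun σ =>
      ⟨fun e => Equiv.ext fun k => a.injective (DFunLike.congr_fun e k), fun e => by rw [e]⟩
    have hcoe : ⇑(τ.toEmbedding.trans a) = a ∘ τ := rfl
    simp [hcoe, phaseSign_comp_perm, phaseSign_mul_self, huniq]
  · obtain ⟨k, hk⟩ : ∃ k, b k ∉ Set.range a := by
      by_contra! hcon
      exact h (exists_perm_of_range_subset (Set.range_subset_iff.2 hcon))
    simp_rw [mul_comm (phaseSign _ a)]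
    rw [sum_phaseSign_mul_eq_zero b.injective hk]
    simp [not_exists.1 h]

end Phases

section Reorder

variable {ι R : Type*} [DecidableEq ι] {t : ℕ}

/-- The operator `∑ τ, |z ∘ τ⟩⟨x ∘ τ|` on `(ℂ^ι)^{⊗t}`, summed over all reorderings `τ` of the
tensor factors. -/
def reorderMatrix (x z : Fin t → ι) : Matrix (Fin t → ι) (Fin t → ι) ℂ :=
  ∑ τ : Equiv.Perm (Fin t), Matrix.single (z ∘ τ) (x ∘ τ) 1

variable [Fintype ι]

theorem tensorPow_mul_reorderMatrix (U : Matrix ι ι ℂ) (x z : Fin t → ι) :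
    tensorPow t U * reorderMatrix x z = ∑ y, tensorPow t U y z • reorderMatrix x y := by
  have hsingle : ∀ τ : Equiv.Perm (Fin t), tensorPow t U * Matrix.single (z ∘ τ) (x ∘ τ) 1 =
      ∑ y : Fin t → ι, tensorPow t U y z • Matrix.single (y ∘ τ) (x ∘ τ) 1 := fun τ => by
    have hcomp : ∀ y, tensorPow t U y z = tensorPow t U (y ∘ τ) (z ∘ τ) := fun y =>
      (Equiv.prod_comp τ fun k => U (y k) (z k)).symm
    have hsum := Equiv.sum_comp (τ.symm.arrowCongr (Equiv.refl ι))
      fun y : Fin t → ι => tensorPow t U y (z ∘ τ) • Matrix.single y (x ∘ τ) (1 : ℂ)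
    refine Eq.trans ?_ (hsum.symm.trans (Finset.sum_congr rfl fun y _ => by rw [hcomp y]; rfl))
    ext a b
    simp [Matrix.sum_apply, Matrix.mul_apply, Matrix.single_apply, ite_and]
  simp only [reorderMatrix, Finset.mul_sum, hsingle, Finset.smul_sum]
  exact Finset.sum_comm

variable [Fintype R] [DecidableEq R]

theorem sum_reApplyInnerSelf_tensorAct_reorderMatrix
    (T : EuclideanSpace ℂ ((Fin t → ι) × R) →L[ℂ] EuclideanSpace ℂ ((Fin t → ι) × R))
    (V : Matrix.unitaryGroup ι ℂ) (φ : EuclideanSpace ℂ ((Fin t → ι) × R)) (x : Fin t → ι) :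
    ∑ z, T.reApplyInnerSelf (tensorAct t R V (ampliation _ R (reorderMatrix x z) φ)) =
      ∑ z, T.reApplyInnerSelf (ampliation _ R (reorderMatrix x z) φ) := by
  have hexpand : ∀ z, tensorAct t R V (ampliation _ R (reorderMatrix x z) φ) =
      ∑ y, tensorPow t V.1 y z • ampliation _ R (reorderMatrix x y) φ := fun z => by
    rw [tensorAct_ampliation_apply, tensorPow_mul_reorderMatrix, map_sum, _root_.sum_apply]
    simp only [map_smul, _root_.smul_apply]
  simp only [hexpand]
  exact sum_reApplyInnerSelf_sum_unitary_smul T ⟨_, tensorPow_mem_unitaryGroup t V⟩ _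

theorem ampliation_reorderMatrix_apply (φ : EuclideanSpace ℂ ((Fin t → ι) × R))
    (x z : Fin t → ι) (p : (Fin t → ι) × R) : ampliation _ R (reorderMatrix x z) φ p =
      ∑ τ ∈ Finset.univ.filter fun τ : Equiv.Perm (Fin t) => z ∘ τ = p.1, φ (x ∘ τ, p.2) := by
  simp only [ampliation_apply, reorderMatrix, Matrix.sum_apply, Matrix.single_apply, Finset.sum_mul,
    ite_and, ite_mul, one_mul, zero_mul]
  rw [Finset.sum_comm, Finset.sum_filter]
  simp

theorem norm_ampliation_reorderMatrix_sq_le (φ : EuclideanSpace ℂ ((Fin t → ι) × R))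
    (x z : Fin t → ι) : ‖ampliation _ R (reorderMatrix x z) φ‖ ^ 2 ≤
      Fintype.card {τ : Equiv.Perm (Fin t) // z ∘ τ = z} *
        ∑ τ : Equiv.Perm (Fin t), ∑ r, ‖φ (x ∘ τ, r)‖ ^ 2 := by
  have hcoord : ∀ a r, ‖ampliation _ R (reorderMatrix x z) φ (a, r)‖ ^ 2 ≤
      Fintype.card {τ : Equiv.Perm (Fin t) // z ∘ τ = z} *
        ∑ τ ∈ Finset.univ.filter fun τ : Equiv.Perm (Fin t) => z ∘ τ = a, ‖φ (x ∘ τ, r)‖ ^ 2 :=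
      fun a r => by
        rw [ampliation_reorderMatrix_apply]
        grw [norm_sum_le, sq_sum_le_card_mul_sum_sq, ← Fintype.card_subtype, card_comp_perm_eq_le]
  calc ‖ampliation _ R (reorderMatrix x z) φ‖ ^ 2
      = ∑ a, ∑ r, ‖ampliation _ R (reorderMatrix x z) φ (a, r)‖ ^ 2 := by
        rw [EuclideanSpace.norm_sq_eq, Fintype.sum_prod_type]
    _ ≤ ∑ a, ∑ r, Fintype.card {τ : Equiv.Perm (Fin t) // z ∘ τ = z} *
          ∑ τ ∈ Finset.univ.filter fun τ : Equiv.Perm (Fin t) => z ∘ τ = a,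
            ‖φ (x ∘ τ, r)‖ ^ 2 :=
        Finset.sum_le_sum fun a _ => Finset.sum_le_sum fun r _ => hcoord a r
    _ = _ := by
        simp only [← Finset.mul_sum]
        simp only [Finset.sum_comm (s := (Finset.univ : Finset R)), Finset.sum_fiberwise]

theorem sum_norm_ampliation_reorderMatrix_sq_le (φ : EuclideanSpace ℂ ((Fin t → ι) × R)) :
    ∑ x : Fin t ↪ ι, ∑ z : Fin t → ι with ¬ z.Injective,
      ‖ampliation _ R (reorderMatrix x z) φ‖ ^ 2 ≤
      ((Fintype.card ι).ascFactorial t - (Fintype.card ι).descFactorial t) *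
        (t.factorial * ‖φ‖ ^ 2) := by
  have hnonneg : (0 : ℝ) ≤ (Fintype.card ι).ascFactorial t - (Fintype.card ι).descFactorial t := by
    rw [← sum_card_comp_perm_eq_not_injective]
    positivity
  have hreorder := sum_sum_comp_perm_le (f := fun a : Fin t → ι => ∑ r, ‖φ (a, r)‖ ^ 2)
    fun a => by positivity
  calc _ ≤ ∑ x : Fin t ↪ ι, ∑ z : Fin t → ι with ¬ z.Injective,
        Fintype.card {τ : Equiv.Perm (Fin t) // z ∘ τ = z} *
          ∑ τ : Equiv.Perm (Fin t), ∑ r, ‖φ (x ∘ τ, r)‖ ^ 2 :=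
        Finset.sum_le_sum fun x _ => Finset.sum_le_sum fun z _ =>
          norm_ampliation_reorderMatrix_sq_le φ x z
    _ = ((Fintype.card ι).ascFactorial t - (Fintype.card ι).descFactorial t) *
        ∑ x : Fin t ↪ ι, ∑ τ : Equiv.Perm (Fin t), ∑ r, ‖φ (x ∘ τ, r)‖ ^ 2 := by
        simp only [← Finset.sum_mul, ← Finset.mul_sum, sum_card_comp_perm_eq_not_injective]
    _ ≤ _ := by
        rw [EuclideanSpace.norm_sq_eq, Fintype.sum_prod_type]
        grw [hreorder, Fintype.card_fin]

end Reorder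

section FactorialDefect

/-- The relative excess `d (d + 1) ⋯ (d + t - 1) / (d (d - 1) ⋯ (d - t + 1)) - 1`, which measures
how far strings of length `t` over `d` letters are from having distinct letters; it is `0` for
`d < t`, where the descending factorial vanishes. -/
def factorialDefect (d t : ℕ) : ℝ := (d.ascFactorial t - d.descFactorial t) / d.descFactorial t

theorem cast_ascFactorial_le_mul_exp {d t : ℕ} (h : 2 * t ≤ d) :
    (d.ascFactorial t : ℝ) ≤ d.descFactorial t * Real.exp (4 * t / d) ^ t := by
  rw [Nat.ascFactorial_eq_prod_range, Nat.descFactorial_eq_prod_range, Nat.cast_prod,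
    Nat.cast_prod]
  conv_rhs => rw [← Finset.card_range t, ← Finset.prod_const, Finset.card_range]
  rw [← Finset.prod_mul_distrib]
  refine Finset.prod_le_prod (fun k _ => by positivity) fun k hk => ?_
  have hkt : k < t := Finset.mem_range.1 hk
  have hd : (0 : ℝ) < d := by exact_mod_cast (by omega : 0 < d)
  have hkd : 2 * (k : ℝ) ≤ d := by exact_mod_cast (by omega : 2 * k ≤ d)
  have hexp : 1 + 4 * (k : ℝ) / d ≤ Real.exp (4 * t / d) := by
    grw [add_comm, Real.add_one_le_exp, hkt.le]
  rw [Nat.cast_sub (by omega), Nat.cast_add, ← sub_nonneg]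
  calc (0 : ℝ) ≤ 2 * k * (d - 2 * k) / d :=
        div_nonneg (mul_nonneg (by positivity) (sub_nonneg.2 hkd)) hd.le
    _ = (d - k) * (1 + 4 * k / d) - (d + k) := by field_simp; ring
    _ ≤ (d - k) * Real.exp (4 * t / d) - (d + k) := by
        gcongr
        linarith

theorem factorialDefect_le {d t : ℕ} (h : 16 * t ^ 2 ≤ d) :
    factorialDefect d t ≤ 8 * ((t : ℝ) ^ 2 / d) := by
  rcases t.eq_zero_or_pos with rfl | ht
  · simp [factorialDefect]
  have htd : 2 * t ≤ d := by nlinarith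
  have hd : (0 : ℝ) < d := by exact_mod_cast (by omega : 0 < d)
  have hdesc : (0 : ℝ) < d.descFactorial t := by
    exact_mod_cast Nat.descFactorial_pos.2 (by omega : t ≤ d)
  have hsmall : |4 * ((t : ℝ) ^ 2 / d)| ≤ 1 := by
    rw [abs_of_nonneg (by positivity), ← mul_div_assoc, div_le_one hd]
    exact_mod_cast (by omega : 4 * t ^ 2 ≤ d)
  have hexp : Real.exp (4 * t / d) ^ t ≤ 1 + 8 * ((t : ℝ) ^ 2 / d) := by
    have hbound := (abs_le.1 (Real.abs_exp_sub_one_le hsmall)).2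
    rw [abs_of_nonneg (by positivity)] at hbound
    rw [← Real.exp_nat_mul, show (t : ℝ) * (4 * t / d) = 4 * ((t : ℝ) ^ 2 / d) by ring]
    linarith
  rw [factorialDefect, div_le_iff₀ hdesc, sub_le_iff_le_add]
  grw [cast_ascFactorial_le_mul_exp htd, hexp]
  exact (by ring : (d.descFactorial t : ℝ) * (1 + 8 * ((t : ℝ) ^ 2 / d)) = _).le

end FactorialDefect

section PhaseMean

open scoped BigOperators

variable {κ ι E : Type*} [Fintype κ] [DecidableEq κ] [NormedAddCommGroup E]
  [InnerProductSpace ℂ E]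

theorem sum_reApplyInnerSelf_sum_perm [Fintype (κ ↪ ι)] (T : E →L[ℂ] E) (v : (κ ↪ ι) → E) :
    ∑ x, T.reApplyInnerSelf (∑ τ : Equiv.Perm κ, v (τ.toEmbedding.trans x)) =
      (Fintype.card κ).factorial *
        ∑ x, ∑ τ : Equiv.Perm κ, (inner ℂ (T (v x)) (v (τ.toEmbedding.trans x))).re := by
  have hshift : ∀ σ : Equiv.Perm κ, ∑ x, ∑ τ : Equiv.Perm κ,
      (inner ℂ (T (v (σ.toEmbedding.trans x))) (v (τ.toEmbedding.trans x))).re =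
      ∑ x, ∑ τ : Equiv.Perm κ, (inner ℂ (T (v x)) (v (τ.toEmbedding.trans x))).re := fun σ =>
    Fintype.sum_equiv (σ.symm.embeddingCongr (Equiv.refl ι)) _ _ fun x =>
      Fintype.sum_equiv (Equiv.mulLeft σ⁻¹) _ _ fun τ => by
        have hx : σ.symm.embeddingCongr (Equiv.refl ι) x = σ.toEmbedding.trans x := rfl
        have hτ : (Equiv.mulLeft σ⁻¹ τ).toEmbedding.trans (σ.toEmbedding.trans x) =
            τ.toEmbedding.trans x := by ext; simp
        rw [hx, hτ]
  simp only [reApplyInnerSelf_sum, RCLike.re_eq_complex_re]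
  rw [Finset.sum_comm, Finset.sum_congr rfl fun σ _ => hshift σ, Finset.sum_const,
    Finset.card_univ, Fintype.card_perm, nsmul_eq_mul]

variable [Fintype ι] [DecidableEq ι]

theorem expect_reApplyInnerSelf_sum_phaseSign_smul (T : E →L[ℂ] E) (v : (κ ↪ ι) → E) :
    𝔼 g : ι → Fin 2, T.reApplyInnerSelf (∑ a : κ ↪ ι, phaseSign g a • v a) =
      ((Fintype.card κ).factorial : ℝ)⁻¹ *
        ∑ x, T.reApplyInnerSelf (∑ τ : Equiv.Perm κ, v (τ.toEmbedding.trans x)) := by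
  have hterm : ∀ (a b : κ ↪ ι) (w : ℂ),
      ((2 ^ Fintype.card ι * ∑ τ : Equiv.Perm κ, if τ.toEmbedding.trans a = b then 1 else 0) *
        w).re = 2 ^ Fintype.card ι *
          ∑ τ : Equiv.Perm κ, if τ.toEmbedding.trans a = b then w.re else 0 := fun a b w => by
    have hpow : ((2 : ℂ) ^ Fintype.card ι) = ((2 ^ Fintype.card ι : ℝ) : ℂ) := by push_cast; rfl
    rw [mul_assoc, hpow, Complex.re_ofReal_mul, Finset.sum_mul, Complex.re_sum]
    simp only [ite_mul, one_mul, zero_mul, apply_ite Complex.re, Complex.zero_re]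
  rw [sum_reApplyInnerSelf_sum_perm, inv_mul_cancel_left₀ (by positivity),
    Fintype.expect_eq_sum_div_card, sum_reApplyInnerSelf_sum_smul]
  simp only [star_phaseSign, sum_phaseSign_mul, RCLike.re_eq_complex_re, hterm, ← Finset.mul_sum]
  rw [Fintype.card_fun, Fintype.card_fin, Nat.cast_pow, Nat.cast_ofNat,
    mul_div_cancel_left₀ _ (by positivity)]
  refine Finset.sum_congr rfl fun a _ => Finset.sum_comm.trans ?_
  simp

end PhaseMean

section DistinctStrings

variable {ι R : Type*} [Fintype ι] [DecidableEq ι] [Fintype R] [DecidableEq R] {t : ℕ}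

/-- The projection of `(ℂ^ι)^{⊗t} ⊗ ℂ^R` onto the span of the basis strings with distinct
letters. -/
def distinctProj (ι R : Type*) [Fintype ι] [DecidableEq ι] [Fintype R] [DecidableEq R] (t : ℕ) :
    EuclideanSpace ℂ ((Fin t → ι) × R) →L[ℂ] EuclideanSpace ℂ ((Fin t → ι) × R) :=
  ampliation _ R (Matrix.diagonal fun a => if a.Injective then 1 else 0)

theorem distinctProj_apply (φ : EuclideanSpace ℂ ((Fin t → ι) × R)) (p : (Fin t → ι) × R) :
    distinctProj ι R t φ p = if p.1.Injective then φ p else 0 := by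
  rw [distinctProj, ampliation_diagonal_apply, ite_mul, one_mul, zero_mul]

theorem norm_distinctProj_apply_le (φ : EuclideanSpace ℂ ((Fin t → ι) × R)) :
    ‖distinctProj ι R t φ‖ ≤ ‖φ‖ := by
  rw [EuclideanSpace.norm_eq, EuclideanSpace.norm_eq]
  refine Real.sqrt_le_sqrt (Finset.sum_le_sum fun p _ => ?_)
  rw [distinctProj_apply]
  split_ifs
  · exact le_rfl
  · simp

theorem sum_embedding_eq_sum_filter_injective {κ M : Type*} [Fintype κ] [DecidableEq κ]
    [AddCommMonoid M] (f : (κ → ι) → M) :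
    ∑ x : κ ↪ ι, f x = ∑ z with Function.Injective z, f z := by
  rw [Finset.sum_subtype (p := Function.Injective) _ fun z => by simp]
  exact (Fintype.sum_equiv (Equiv.subtypeInjectiveEquivEmbedding κ ι) _ _ fun _ => rfl).symm

end DistinctStrings

section PermPhaseMean

open scoped BigOperators

variable {n t : ℕ} {R : Type*} [Fintype R] [DecidableEq R]

theorem tensorPow_permUnitary_mul_phaseUnitary_apply (π : Equiv.Perm (Bits n)) (g : Bits n → Fin 2)
    (y a : Fin t → Bits n) : tensorPow t (permUnitary π * phaseUnitary g).1 y a =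
      if y = π ∘ a then phaseSign g a else 0 := by
  have hentry : ∀ k, (permUnitary π * phaseUnitary g).1 (y k) (a k) =
      if y k = π (a k) then (-1 : ℂ) ^ (g (a k) : ℕ) else 0 := fun k => by
    simp [permUnitary, phaseUnitary]
  simp only [tensorPow, Matrix.of_apply, hentry, Finset.prod_ite_zero, Finset.mem_univ,
    forall_true_left, phaseSign, funext_iff, Function.comp_apply]

theorem tensorAct_permUnitary_mul_phaseUnitary_distinctProj (π : Equiv.Perm (Bits n))
    (g : Bits n → Fin 2) (φ : EuclideanSpace ℂ ((Fin t → Bits n) × R)) :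
    tensorAct t R (permUnitary π * phaseUnitary g) (distinctProj (Bits n) R t φ) =
      ∑ a : Fin t ↪ Bits n, phaseSign g a • ampliation _ R (Matrix.single (π ∘ a) a 1) φ := by
  have hmatrix : tensorPow t (permUnitary π * phaseUnitary g).1 *
      Matrix.diagonal (fun a => if a.Injective then 1 else 0) =
      ∑ a : Fin t ↪ Bits n, phaseSign g a • Matrix.single (π ∘ a) (a : Fin t → Bits n) 1 := by
    ext y b
    rw [sum_embedding_eq_sum_filter_injective fun a => phaseSign g a • Matrix.single (π ∘ a) a 1,
      Matrix.mul_diagonal, tensorPow_permUnitary_mul_phaseUnitary_apply, Matrix.sum_apply,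
      Finset.sum_filter, Finset.sum_eq_single b]
    · simp [Matrix.single_apply, eq_comm]
    · intro a _ hab
      simp [hab]
    · simp
  rw [distinctProj, tensorAct_ampliation_apply, hmatrix, map_sum, _root_.sum_apply]
  simp only [map_smul, _root_.smul_apply]

/-- The mean of the quadratic form of `T` over the images of `φ` under the operators
`(P F)^{⊗t} ⊗ 1`, with `P` a uniform permutation operator and `F` a uniform phase operator. -/
def permPhaseMean
    (T : EuclideanSpace ℂ ((Fin t → Bits n) × R) →L[ℂ] EuclideanSpace ℂ ((Fin t → Bits n) × R))
    (φ : EuclideanSpace ℂ ((Fin t → Bits n) × R)) : ℝ :=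
  𝔼 π, 𝔼 g, T.reApplyInnerSelf (tensorAct t R (permUnitary π * phaseUnitary g) φ)

theorem permPhaseMean_distinctProj
    (T : EuclideanSpace ℂ ((Fin t → Bits n) × R) →L[ℂ] EuclideanSpace ℂ ((Fin t → Bits n) × R))
    (φ : EuclideanSpace ℂ ((Fin t → Bits n) × R)) :
    permPhaseMean T (distinctProj (Bits n) R t φ) = (t.factorial : ℝ)⁻¹ *
      ∑ x : Fin t ↪ Bits n, 𝔼 z : Fin t ↪ Bits n,
        T.reApplyInnerSelf (ampliation _ R (reorderMatrix x z) φ) := by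
  have hphase : ∀ π : Equiv.Perm (Bits n), 𝔼 g, T.reApplyInnerSelf
      (tensorAct t R (permUnitary π * phaseUnitary g) (distinctProj (Bits n) R t φ)) =
      (t.factorial : ℝ)⁻¹ * ∑ x : Fin t ↪ Bits n,
        T.reApplyInnerSelf (ampliation _ R (reorderMatrix x (π • x : Fin t ↪ Bits n)) φ) :=
    fun π => by
      simp only [tensorAct_permUnitary_mul_phaseUnitary_distinctProj]
      rw [expect_reApplyInnerSelf_sum_phaseSign_smul, Fintype.card_fin]
      simp only [reorderMatrix, map_sum, _root_.sum_apply]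
      rfl
  have hperm : ∀ x : Fin t ↪ Bits n, 𝔼 π : Equiv.Perm (Bits n), T.reApplyInnerSelf
      (ampliation _ R (reorderMatrix x (π • x : Fin t ↪ Bits n)) φ) =
      𝔼 z : Fin t ↪ Bits n, T.reApplyInnerSelf (ampliation _ R (reorderMatrix x z) φ) := fun x => by
    have := Equiv.Perm.isMultiplyPretransitive (Bits n) t
    exact expect_smul_eq_expect (fun z : Fin t ↪ Bits n => T.reApplyInnerSelf
      (ampliation _ R (reorderMatrix x z) φ)) x
  simp only [permPhaseMean, hphase]
  rw [← Finset.mul_expect, Finset.expect_sum_comm]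
  simp only [hperm]

theorem sum_reApplyInnerSelf_reorderMatrix_sub_le
    {T : EuclideanSpace ℂ ((Fin t → Bits n) × R) →L[ℂ] EuclideanSpace ℂ ((Fin t → Bits n) × R)}
    (hT : ‖T‖ ≤ 1) (V : QU n) (φ : EuclideanSpace ℂ ((Fin t → Bits n) × R)) (x : Fin t → Bits n) :
    ∑ z : Fin t ↪ Bits n, T.reApplyInnerSelf (ampliation _ R (reorderMatrix x z) φ) -
      ∑ z : Fin t ↪ Bits n,
        T.reApplyInnerSelf (tensorAct t R V (ampliation _ R (reorderMatrix x z) φ)) ≤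
      2 * ∑ z : Fin t → Bits n with ¬ z.Injective, ‖ampliation _ R (reorderMatrix x z) φ‖ ^ 2 := by
  have htotal := sum_reApplyInnerSelf_tensorAct_reorderMatrix T V φ x
  rw [← Finset.sum_filter_add_sum_filter_not _ Function.Injective,
    ← Finset.sum_filter_add_sum_filter_not Finset.univ Function.Injective] at htotal
  have hle : ∀ z : Fin t → Bits n,
      T.reApplyInnerSelf (tensorAct t R V (ampliation _ R (reorderMatrix x z) φ)) -
      T.reApplyInnerSelf (ampliation _ R (reorderMatrix x z) φ) ≤
      2 * ‖ampliation _ R (reorderMatrix x z) φ‖ ^ 2 := fun z => by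
    have hV := abs_reApplyInnerSelf_le_of_norm_le_one hT
      (tensorAct t R V (ampliation _ R (reorderMatrix x z) φ))
    rw [norm_tensorAct_apply] at hV
    linarith [(abs_le.1 hV).2,
      (abs_le.1 (abs_reApplyInnerSelf_le_of_norm_le_one hT
        (ampliation _ R (reorderMatrix x z) φ))).1]
  rw [sum_embedding_eq_sum_filter_injective fun z => T.reApplyInnerSelf
      (ampliation _ R (reorderMatrix x z) φ),
    sum_embedding_eq_sum_filter_injective fun z => T.reApplyInnerSelf
      (tensorAct t R V (ampliation _ R (reorderMatrix x z) φ)), Finset.mul_sum]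
  have htail := Finset.sum_le_sum (s := Finset.univ.filter fun z : Fin t → Bits n => ¬ z.Injective)
    fun z _ => hle z
  rw [Finset.sum_sub_distrib] at htail
  linarith

theorem permPhaseMean_distinctProj_sub_le
    {T : EuclideanSpace ℂ ((Fin t → Bits n) × R) →L[ℂ] EuclideanSpace ℂ ((Fin t → Bits n) × R)}
    (hT : ‖T‖ ≤ 1) (V : QU n) (φ : EuclideanSpace ℂ ((Fin t → Bits n) × R)) :
    permPhaseMean T (distinctProj (Bits n) R t φ) -
      permPhaseMean (star (tensorAct t R V) * T * tensorAct t R V) (distinctProj (Bits n) R t φ) ≤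
      2 * factorialDefect (2 ^ n) t * ‖φ‖ ^ 2 := by
  have hcard : Fintype.card (Fin t ↪ Bits n) = (2 ^ n).descFactorial t := by
    simp [Fintype.card_embedding_eq]
  simp only [permPhaseMean_distinctProj, reApplyInnerSelf_star_mul_mul,
    Fintype.expect_eq_sum_div_card, ← Finset.sum_div, hcard]
  rw [← mul_sub, ← sub_div, ← Finset.sum_sub_distrib]
  grw [Finset.sum_le_sum fun (x : Fin t ↪ Bits n) _ =>
    sum_reApplyInnerSelf_reorderMatrix_sub_le hT V φ x, ← Finset.mul_sum,
    sum_norm_ampliation_reorderMatrix_sq_le]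
  apply le_of_eq
  rw [factorialDefect]
  simp only [Fintype.card_fun, Fintype.card_fin]
  field_simp

theorem abs_permPhaseMean_sub_le
    {T : EuclideanSpace ℂ ((Fin t → Bits n) × R) →L[ℂ] EuclideanSpace ℂ ((Fin t → Bits n) × R)}
    (hT : ‖T‖ ≤ 1) {φ ψ : EuclideanSpace ℂ ((Fin t → Bits n) × R)} (h : ‖ψ‖ ≤ ‖φ‖) :
    |permPhaseMean T φ - permPhaseMean T ψ| ≤ 2 * ‖φ‖ * ‖φ - ψ‖ := by
  simp only [permPhaseMean, ← Finset.expect_sub_distrib]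
  refine (Finset.abs_expect_le _ _).trans (Finset.expect_le Finset.univ_nonempty fun π _ => ?_)
  refine (Finset.abs_expect_le _ _).trans (Finset.expect_le Finset.univ_nonempty fun g _ => ?_)
  refine (abs_reApplyInnerSelf_sub_le T _ _).trans ?_
  rw [← map_sub, norm_tensorAct_apply, norm_tensorAct_apply, norm_tensorAct_apply]
  grw [hT, h]
  exact (by ring : 1 * ((‖φ‖ + ‖φ‖) * ‖φ - ψ‖) = 2 * ‖φ‖ * ‖φ - ψ‖).le

theorem permPhaseMean_sub_le
    {T : EuclideanSpace ℂ ((Fin t → Bits n) × R) →L[ℂ] EuclideanSpace ℂ ((Fin t → Bits n) × R)}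
    (hT : ‖T‖ ≤ 1) (V : QU n) {φ : EuclideanSpace ℂ ((Fin t → Bits n) × R)} (hφ : ‖φ‖ = 1) :
    permPhaseMean T φ - permPhaseMean (star (tensorAct t R V) * T * tensorAct t R V) φ ≤
      4 * ‖φ - distinctProj (Bits n) R t φ‖ + 2 * factorialDefect (2 ^ n) t := by
  have hcut := fun (S : EuclideanSpace ℂ ((Fin t → Bits n) × R) →L[ℂ] _) (hS : ‖S‖ ≤ 1) =>
    abs_le.1 (abs_permPhaseMean_sub_le hS (norm_distinctProj_apply_le φ))
  have hdistinct := permPhaseMean_distinctProj_sub_le hT V φ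
  rw [hφ] at hcut hdistinct
  linarith [(hcut T hT).2, (hcut _ (norm_star_mul_mul_le_one (tensorAct_mem_unitary V) hT)).1]

end PermPhaseMean

section Pauli

variable {n : ℕ}

/-- The sign with which two single-qubit Pauli matrices commute. -/
def pauliSign (a b : Fin 4) : ℤˣ := if a = 0 ∨ b = 0 ∨ a = b then 1 else -1

theorem exists_pauliSign_eq_neg_one :
    ∀ {a b : Fin 4}, a ≠ 0 → b ≠ 0 → ∃ c, pauliSign a c = -1 ∧ pauliSign b c = -1 := by
  decide

theorem pauliSign_zero_left (b : Fin 4) : pauliSign 0 b = 1 := if_pos (Or.inl rfl)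

theorem pauliSign_zero_right (a : Fin 4) : pauliSign a 0 = 1 := if_pos (Or.inr (Or.inl rfl))

theorem pauli_mul_comm (a b : Fin 4) :
    pauli a * pauli b = pauliSign a b • (pauli b * pauli a) := by
  fin_cases a <;> fin_cases b <;> simp [pauli, pauliSign]

theorem pauli_mul_self (a : Fin 4) : pauli a * pauli a = 1 := by
  fin_cases a <;> simp [pauli, Matrix.one_fin_two]

theorem pauliString_eq_piKronecker (p : Fin n → Fin 4) :
    pauliString p = piKronecker fun k => pauli (p k) := rfl

theorem pauliString_mul_self (p : Fin n → Fin 4) : pauliString p * pauliString p = 1 := by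
  simp only [pauliString_eq_piKronecker, piKronecker_mul, pauli_mul_self, piKronecker_one]

/-- The sign with which two Pauli strings commute. -/
def stringSign (p q : Fin n → Fin 4) : ℤˣ := ∏ k, pauliSign (p k) (q k)

theorem pauliString_mul_comm (p q : Fin n → Fin 4) :
    pauliString p * pauliString q = stringSign p q • (pauliString q * pauliString p) := by
  simp only [pauliString_eq_piKronecker, piKronecker_mul, stringSign, pauli_mul_comm (p _) (q _),
    piKronecker_smul]

theorem stringSign_single (p : Fin n → Fin 4) (i : Fin n) (c : Fin 4) :
    stringSign p (Pi.single i c) = pauliSign (p i) c := by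
  rw [stringSign, Fintype.prod_eq_single i fun k hk => ?_, Pi.single_eq_same]
  rw [Pi.single_eq_of_ne hk, pauliSign_zero_right]

theorem stringSign_add_single (p : Fin n → Fin 4) {i j : Fin n} (hij : i ≠ j) (c d : Fin 4) :
    stringSign p (Pi.single i c + Pi.single j d) = pauliSign (p i) c * pauliSign (p j) d := by
  rw [stringSign, Fintype.prod_eq_mul i j hij fun k hk => ?_]
  · simp [hij, hij.symm]
  · simp [hk.1, hk.2, pauliSign_zero_right]

theorem exists_stringSign_eq_neg_one {p q : Fin n → Fin 4} (hp : p ≠ 0) (hq : q ≠ 0) :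
    ∃ r, stringSign p r = -1 ∧ stringSign q r = -1 := by
  obtain ⟨i, hi⟩ := Function.ne_iff.1 hp
  obtain ⟨j, hj⟩ := Function.ne_iff.1 hq
  by_cases hqi : q i = 0
  · by_cases hpj : p j = 0
    · have hij : i ≠ j := by rintro rfl; exact hi hpj
      obtain ⟨c, hc, -⟩ := exists_pauliSign_eq_neg_one hi hi
      obtain ⟨d, hd, -⟩ := exists_pauliSign_eq_neg_one hj hj
      refine ⟨Pi.single i c + Pi.single j d, ?_⟩
      simp only [stringSign_add_single _ hij, hc, hd, hqi, hpj, pauliSign_zero_left, one_mul,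
        mul_one, and_self]
    · obtain ⟨c, hc⟩ := exists_pauliSign_eq_neg_one hpj hj
      exact ⟨Pi.single j c, by simpa only [stringSign_single] using hc⟩
  · obtain ⟨c, hc⟩ := exists_pauliSign_eq_neg_one hi hqi
    exact ⟨Pi.single i c, by simpa only [stringSign_single] using hc⟩

end Pauli

section PauliSwap

theorem add_mul_mul_add_of_commSign_eq {A : Type*} [Ring A] {P Q V : A} {u : ℤˣ} (hP : P * P = 1)
    (hQ : Q * Q = 1) (hPQ : P * Q = -(Q * P)) (hPV : P * V = u • (V * P))
    (hQV : Q * V = u • (V * Q)) : (P + Q) * V * (P + Q) = 2 • u • V := by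
  have hsq : (P + Q) * (P + Q) = 2 := by
    rw [add_mul, mul_add, mul_add, hP, hQ, hPQ, ← one_add_one_eq_two]
    abel
  rw [add_mul, hPV, hQV, ← smul_add, ← mul_add, smul_mul_assoc, mul_assoc, hsq, mul_two, two_nsmul,
    smul_add]

theorem add_mul_mul_add_of_commSign_eq_neg {A : Type*} [Ring A] {P Q V : A} {u : ℤˣ}
    (hP : P * P = 1) (hQ : Q * Q = 1) (hPQ : P * Q = -(Q * P)) (hPV : P * V = u • (V * P))
    (hQV : Q * V = -u • (V * Q)) : (P + Q) * V * (P + Q) = 2 • u • (V * (P * Q)) := by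
  have hprod : (P - Q) * (P + Q) = P * Q + P * Q := by
    rw [sub_mul, mul_add, mul_add, hP, hQ, ← neg_eq_iff_eq_neg.2 hPQ]
    abel
  rw [add_mul, hPV, hQV, Units.neg_smul, ← sub_eq_add_neg, ← smul_sub, ← mul_sub, smul_mul_assoc,
    mul_assoc, hprod, mul_add, two_nsmul, smul_add]

variable {n : ℕ} {p q : Fin n → Fin 4}

theorem pauliString_mul_eq_neg (h : stringSign p q = -1) :
    pauliString p * pauliString q = -(pauliString q * pauliString p) := by
  rw [pauliString_mul_comm, h, Units.neg_smul, one_smul]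

theorem exists_I_pow_smul_eq_units_smul {A : Type*} [AddCommGroup A] [Module ℂ A] (u : ℤˣ) (a : A) :
    ∃ k : ℕ, u • a = Complex.I ^ k • a := by
  rcases Int.units_eq_one_or u with rfl | rfl
  · exact ⟨0, by simp⟩
  · exact ⟨2, by simp⟩

theorem exists_add_mul_pauliString_mul_add (h : stringSign p q = -1) (r : Fin n → Fin 4) :
    ∃ (k : ℕ) (s : Fin n → Fin 4), (pauliString p + pauliString q) * pauliString r *
      (pauliString p + pauliString q) = 2 • Complex.I ^ k • pauliString s := by
  have hconj : stringSign q r = stringSign p r ∨ stringSign q r = -stringSign p r := by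
    rcases Int.units_eq_one_or (stringSign p r) with hp | hp <;>
      rcases Int.units_eq_one_or (stringSign q r) with hq | hq <;> simp [hp, hq]
  have hpr := pauliString_mul_comm p r
  have hqr := pauliString_mul_comm q r
  rcases hconj with hs | hs <;> rw [hs] at hqr
  · obtain ⟨k, hk⟩ := exists_I_pow_smul_eq_units_smul (stringSign p r) (pauliString r)
    exact ⟨k, r, hk ▸ add_mul_mul_add_of_commSign_eq (pauliString_mul_self p)
      (pauliString_mul_self q) (pauliString_mul_eq_neg h) hpr hqr⟩
  · obtain ⟨k, v, hpq⟩ := pauliString_mul p q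
    obtain ⟨l, w, hrv⟩ := pauliString_mul r v
    obtain ⟨m, hm⟩ := exists_I_pow_smul_eq_units_smul (stringSign p r)
      (pauliString r * (pauliString p * pauliString q))
    refine ⟨m + k + l, w, (add_mul_mul_add_of_commSign_eq_neg (pauliString_mul_self p)
      (pauliString_mul_self q) (pauliString_mul_eq_neg h) hpr hqr).trans ?_⟩
    rw [hm, hpq, mul_smul_comm, hrv, smul_smul, smul_smul, pow_add, pow_add, mul_assoc]

/-- The Hermitian matrix `(σ_p + σ_q) / √2`. For anticommuting Pauli strings it is a Clifford
unitary exchanging `σ_p` and `σ_q` under conjugation, just as the Hadamard gate exchanges `X` and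
`Z`. -/
def pauliHadamard (p q : Fin n → Fin 4) : Matrix (Bits n) (Bits n) ℂ :=
  ((√2)⁻¹ : ℝ) • (pauliString p + pauliString q)

theorem pauliHadamard_conjTranspose (p q : Fin n → Fin 4) :
    (pauliHadamard p q)ᴴ = pauliHadamard p q := by
  rw [pauliHadamard, Matrix.conjTranspose_smul, Matrix.conjTranspose_add,
    pauliString_conjTranspose, pauliString_conjTranspose, star_trivial]

theorem pauliHadamard_mul_mul {M N : Matrix (Bits n) (Bits n) ℂ}
    (h : (pauliString p + pauliString q) * M * (pauliString p + pauliString q) = 2 • N) :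
    pauliHadamard p q * M * pauliHadamard p q = N := by
  have hsq : (√2)⁻¹ * (√2)⁻¹ = (2⁻¹ : ℝ) := by
    rw [← mul_inv, Real.mul_self_sqrt zero_le_two]
  rw [pauliHadamard, smul_mul_assoc, smul_mul_assoc, mul_smul_comm, smul_smul, hsq, h,
    ← ofNat_smul_eq_nsmul ℝ, inv_smul_smul₀ two_ne_zero]

theorem pauliHadamard_mul_self (h : stringSign p q = -1) :
    pauliHadamard p q * pauliHadamard p q = 1 := by
  have hone := add_mul_mul_add_of_commSign_eq (V := 1) (u := 1) (pauliString_mul_self p)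
    (pauliString_mul_self q) (pauliString_mul_eq_neg h) (by simp) (by simp)
  rw [one_smul] at hone
  simpa only [mul_one] using pauliHadamard_mul_mul hone

theorem pauliHadamard_mem_unitaryGroup (h : stringSign p q = -1) :
    pauliHadamard p q ∈ Matrix.unitaryGroup (Bits n) ℂ := by
  rw [Matrix.mem_unitaryGroup_iff, Matrix.star_eq_conjTranspose, pauliHadamard_conjTranspose,
    pauliHadamard_mul_self h]

theorem mem_cliffordGroup_of_conj_mem {U : QU n}
    (h : ∀ V ∈ pauliGroup n, U * V * U⁻¹ ∈ pauliGroup n) : U ∈ cliffordGroup n :=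
  have : Finite (pauliGroup n : Set (QU n)) := (pauliGroup_finite n).to_subtype
  Subgroup.mem_normalizer_fintype h

theorem pauliHadamard_mem_cliffordGroup (h : stringSign p q = -1) :
    ⟨pauliHadamard p q, pauliHadamard_mem_unitaryGroup h⟩ ∈ cliffordGroup n := by
  refine mem_cliffordGroup_of_conj_mem fun V ⟨l, r, hV⟩ => ?_
  obtain ⟨k, s, hks⟩ := exists_add_mul_pauliString_mul_add h r
  refine ⟨l + k, s, ?_⟩
  change pauliHadamard p q * V.1 * (pauliHadamard p q)ᴴ = _
  rw [pauliHadamard_conjTranspose, hV, mul_smul_comm, smul_mul_assoc, pauliHadamard_mul_mul hks,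
    smul_smul, pow_add]

theorem exists_mem_cliffordGroup_star_mul_pauliString_mul (h : stringSign p q = -1) :
    ∃ V ∈ cliffordGroup n, star V.1 * pauliString p * V.1 = pauliString q := by
  refine ⟨_, pauliHadamard_mem_cliffordGroup h, ?_⟩
  have hexch : (pauliString p + pauliString q) * pauliString p * (pauliString p + pauliString q) =
      2 • pauliString q := by
    have := add_mul_mul_add_of_commSign_eq_neg (V := pauliString p) (u := 1)
      (pauliString_mul_self p) (pauliString_mul_self q) (pauliString_mul_eq_neg h) (by simp)
      (by rw [Units.neg_smul, one_smul, pauliString_mul_eq_neg h, neg_neg])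
    rwa [← mul_assoc, pauliString_mul_self, one_mul, one_smul] at this
  change (pauliHadamard p q)ᴴ * _ * pauliHadamard p q = _
  rw [pauliHadamard_conjTranspose, pauliHadamard_mul_mul hexch]

end PauliSwap

section PairOp

variable {ι R : Type*} [DecidableEq ι] [Fintype R] [DecidableEq R] {t : ℕ}

/-- `M` acting on the tensor factors `i` and `j`, and the identity on the others. -/
def pairOp (i j : Fin t) (M : Matrix ι ι ℂ) : Matrix (Fin t → ι) (Fin t → ι) ℂ :=
  piKronecker fun k => if k = i ∨ k = j then M else 1

theorem pairOp_one (i j : Fin t) : pairOp i j (1 : Matrix ι ι ℂ) = 1 := by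
  simp only [pairOp, ite_self, piKronecker_one]

theorem star_tensorAct_mul_ampliation_pairOp_mul [Fintype ι] (i j : Fin t) (M : Matrix ι ι ℂ)
    (U : Matrix.unitaryGroup ι ℂ) :
    star (tensorAct t R U) * ampliation _ R (pairOp i j M) * tensorAct t R U =
      ampliation _ R (pairOp i j (star U.1 * M * U.1)) := by
  have hconj : star (tensorPow t U.1) * pairOp i j M * tensorPow t U.1 =
      pairOp i j (star U.1 * M * U.1) := by
    change (piKronecker fun _ => U.1)ᴴ * pairOp i j M * piKronecker (fun _ => U.1) = _
    simp only [piKronecker_conjTranspose, pairOp, piKronecker_mul]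
    congr 1
    funext k
    split_ifs
    · rfl
    · rw [mul_one]
      exact Matrix.mem_unitaryGroup_iff'.1 U.2
  change star (ampliation _ R (tensorPow t U.1)) * _ * ampliation _ R (tensorPow t U.1) = _
  rw [← map_star, ← map_mul, ← map_mul, hconj]

theorem pairOp_apply {i j : Fin t} (hij : i ≠ j) (M : Matrix ι ι ℂ) (a b : Fin t → ι) :
    pairOp i j M a b =
      if ∀ k, k ≠ i → k ≠ j → a k = b k then M (a i) (b i) * M (a j) (b j) else 0 := by
  have hrest : ∀ k ∈ (Finset.univ.erase i).erase j,
      (if k = i ∨ k = j then M else 1) (a k) (b k) = if a k = b k then 1 else 0 := fun k hk => by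
    simp only [Finset.mem_erase] at hk
    rw [if_neg (by tauto), Matrix.one_apply]
  rw [pairOp, piKronecker, Matrix.of_apply, ← Finset.mul_prod_erase _ _ (Finset.mem_univ i),
    ← Finset.mul_prod_erase _ _ (Finset.mem_erase.2 ⟨hij.symm, Finset.mem_univ j⟩),
    Finset.prod_congr rfl hrest, Finset.prod_ite_zero, ← mul_assoc, mul_ite_zero]
  simp only [true_or, or_true, if_true, Finset.prod_const_one, mul_one]
  refine if_congr (forall_congr' fun k => ?_) rfl rfl
  simp only [Finset.mem_erase, Finset.mem_univ]
  tauto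

end PairOp

section PauliSums

variable {n t : ℕ}

theorem sum_pauli_mul_pauli (x y z w : Fin 2) :
    ∑ a, pauli a x y * pauli a z w = if y = z ∧ w = x then 2 else 0 := by
  rw [Fin.sum_univ_four]
  fin_cases x <;> fin_cases y <;> fin_cases z <;> fin_cases w <;> simp [pauli] <;> norm_num

theorem sum_pauli_diagonal (x y z w : Fin 2) :
    ∑ s : Fin 2, pauli (![0, 3] s) x y * pauli (![0, 3] s) z w =
      if x = y ∧ z = w ∧ x = z then 2 else 0 := by
  rw [Fin.sum_univ_two]
  fin_cases x <;> fin_cases y <;> fin_cases z <;> fin_cases w <;> simp [pauli] <;> norm_num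

theorem sum_pauliString_mul_pauliString (x y z w : Bits n) :
    ∑ p : Fin n → Fin 4, pauliString p x y * pauliString p z w =
      if y = z ∧ w = x then 2 ^ n else 0 := by
  simp only [pauliString, Matrix.of_apply, ← Finset.prod_mul_distrib]
  refine (Finset.prod_univ_sum (fun _ => Finset.univ)
    (fun k a => pauli a (x k) (y k) * pauli a (z k) (w k))).symm.trans ?_
  simp only [sum_pauli_mul_pauli, Finset.prod_ite_zero, funext_iff, Finset.mem_univ, true_implies,
    forall_and, Finset.prod_const, Finset.card_univ, Fintype.card_fin]

/-- The Pauli string with a `Z` wherever `z` is `1`. -/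
def zString (z : Bits n) : Fin n → Fin 4 := fun k => ![0, 3] (z k)

theorem zString_zero : zString (0 : Bits n) = 0 := rfl

theorem zString_ne_zero {z : Bits n} (hz : z ≠ 0) : zString z ≠ 0 := by
  obtain ⟨k, hk⟩ := Function.ne_iff.1 hz
  have hletter : ∀ s : Fin 2, s ≠ 0 → (![0, 3] s : Fin 4) ≠ 0 := by decide
  exact Function.ne_iff.2 ⟨k, hletter _ hk⟩

theorem sum_zString_mul_zString (x y u w : Bits n) :
    ∑ z : Bits n, pauliString (zString z) x y * pauliString (zString z) u w =
      if x = y ∧ u = w ∧ x = u then 2 ^ n else 0 := by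
  simp only [pauliString, zString, Matrix.of_apply, ← Finset.prod_mul_distrib]
  refine (Finset.prod_univ_sum (fun _ => Finset.univ)
    (fun k s => pauli (![0, 3] s) (x k) (y k) * pauli (![0, 3] s) (u k) (w k))).symm.trans ?_
  simp only [sum_pauli_diagonal, Finset.prod_ite_zero, funext_iff, Finset.mem_univ, true_implies,
    forall_and, Finset.prod_const, Finset.card_univ, Fintype.card_fin]

/-- The projection onto the strings whose letters at `i` and `j` collide. -/
def collisionProj {ι : Type*} [DecidableEq ι] (i j : Fin t) :
    Matrix (Fin t → ι) (Fin t → ι) ℂ :=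
  Matrix.diagonal fun a => if a i = a j then 1 else 0

theorem eq_iff_of_forall_ne {κ ι : Type*} (i j : κ) {a b : κ → ι} :
    a = b ↔ a i = b i ∧ a j = b j ∧ ∀ k, k ≠ i → k ≠ j → a k = b k := by
  refine ⟨fun h => h ▸ ⟨rfl, rfl, fun _ _ _ => rfl⟩, fun ⟨hi, hj, h⟩ => funext fun k => ?_⟩
  by_cases hki : k = i
  · exact hki ▸ hi
  by_cases hkj : k = j
  · exact hkj ▸ hj
  exact h k hki hkj

theorem sum_pairOp_pauliString {i j : Fin t} (hij : i ≠ j) :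
    ∑ p, pairOp i j (pauliString p) = 2 ^ n •
      Equiv.Perm.permMatrix ℂ ((Equiv.swap i j).arrowCongr (Equiv.refl (Bits n))) := by
  ext a b
  have hiff : (∀ k, k ≠ i → k ≠ j → a k = b k) ∧ b i = a j ∧ b j = a i ↔
      a ∘ Equiv.swap i j = b := by
    rw [eq_iff_of_forall_ne i j]
    simp +contextual only [Function.comp_apply, Equiv.swap_apply_left, Equiv.swap_apply_right,
      ne_eq, Equiv.swap_apply_of_ne_of_ne, not_false_eq_true]
    tauto
  simp only [Matrix.sum_apply, pairOp_apply hij, Finset.sum_ite_irrel, Finset.sum_const_zero,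
    sum_pauliString_mul_pauliString, ← ite_and]
  simp [Equiv.arrowCongr, Matrix.smul_apply, PEquiv.toMatrix_apply, Equiv.toPEquiv_apply, hiff]

theorem sum_pairOp_zString {i j : Fin t} (hij : i ≠ j) :
    ∑ z : Bits n, pairOp i j (pauliString (zString z)) = 2 ^ n • collisionProj i j := by
  ext a b
  have hiff : (∀ k, k ≠ i → k ≠ j → a k = b k) ∧ a i = b i ∧ a j = b j ∧ a i = a j ↔
      a = b ∧ a i = a j := by
    rw [eq_iff_of_forall_ne i j]
    tauto
  simp only [Matrix.sum_apply, pairOp_apply hij, Finset.sum_ite_irrel, Finset.sum_const_zero,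
    sum_zString_mul_zString, ← ite_and, hiff]
  simp [collisionProj, Matrix.smul_apply, Matrix.diagonal_apply, ite_and]

end PauliSums

section CliffordMean

variable {n t : ℕ} {R : Type*} [Fintype R] [DecidableEq R]

/-- The mean of the quadratic form of `T` over the images of `ψ` under the operators
`C^{⊗t} ⊗ 1`, with `C` a uniform Clifford unitary. -/
def cliffordMean
    (T : EuclideanSpace ℂ ((Fin t → Bits n) × R) →L[ℂ] EuclideanSpace ℂ ((Fin t → Bits n) × R))
    (ψ : EuclideanSpace ℂ ((Fin t → Bits n) × R)) : ℝ :=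
  ∫ C, T.reApplyInnerSelf (tensorAct t R C ψ) ∂(cliffordEnsemble n : Measure (QU n))

theorem cliffordMean_sum {α : Type*} (s : Finset α) (T : α →
      EuclideanSpace ℂ ((Fin t → Bits n) × R) →L[ℂ] EuclideanSpace ℂ ((Fin t → Bits n) × R))
    (ψ : EuclideanSpace ℂ ((Fin t → Bits n) × R)) :
    cliffordMean (∑ i ∈ s, T i) ψ = ∑ i ∈ s, cliffordMean (T i) ψ := by
  simp only [cliffordMean, reApplyInnerSelf_sum_apply]
  exact integral_finsetSum _ fun i _ =>
    integrable_of_continuous (continuous_reApplyInnerSelf_tensorAct_apply (T i) ψ) _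

theorem cliffordMean_nsmul (m : ℕ)
    (T : EuclideanSpace ℂ ((Fin t → Bits n) × R) →L[ℂ] EuclideanSpace ℂ ((Fin t → Bits n) × R))
    (ψ : EuclideanSpace ℂ ((Fin t → Bits n) × R)) :
    cliffordMean (m • T) ψ = m * cliffordMean T ψ := by
  simpa using cliffordMean_sum (Finset.range m) (fun _ => T) ψ

theorem cliffordMean_one (ψ : EuclideanSpace ℂ ((Fin t → Bits n) × R)) :
    cliffordMean 1 ψ = ‖ψ‖ ^ 2 := by
  have hone : ∀ φ : EuclideanSpace ℂ ((Fin t → Bits n) × R),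
      (1 : EuclideanSpace ℂ ((Fin t → Bits n) × R) →L[ℂ] _).reApplyInnerSelf φ = ‖φ‖ ^ 2 :=
    inner_self_eq_norm_sq (𝕜 := ℂ)
  simp [cliffordMean, hone, norm_tensorAct_apply]

theorem cliffordMean_le
    {T : EuclideanSpace ℂ ((Fin t → Bits n) × R) →L[ℂ] EuclideanSpace ℂ ((Fin t → Bits n) × R)}
    (hT : ‖T‖ ≤ 1) (ψ : EuclideanSpace ℂ ((Fin t → Bits n) × R)) :
    cliffordMean T ψ ≤ ‖ψ‖ ^ 2 := by
  have hle := integral_mono (integrable_of_continuous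
    (continuous_reApplyInnerSelf_tensorAct_apply T ψ) (cliffordEnsemble n : Measure (QU n)))
    (integrable_const (‖ψ‖ ^ 2)) fun C => (norm_tensorAct_apply C ψ) ▸
      (abs_le.1 (abs_reApplyInnerSelf_le_of_norm_le_one hT (tensorAct t R C ψ))).2
  simpa [cliffordMean] using hle

theorem cliffordMean_star_mul_mul {V : QU n} (hV : V ∈ cliffordGroup n)
    (T : EuclideanSpace ℂ ((Fin t → Bits n) × R) →L[ℂ] EuclideanSpace ℂ ((Fin t → Bits n) × R))
    (ψ : EuclideanSpace ℂ ((Fin t → Bits n) × R)) :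
    cliffordMean (star (tensorAct t R V) * T * tensorAct t R V) ψ = cliffordMean T ψ := by
  rw [cliffordMean, cliffordMean, ← integral_cliffordEnsemble_mul_left hV
    (continuous_reApplyInnerSelf_tensorAct_apply T ψ)]
  simp only [reApplyInnerSelf_star_mul_mul, map_mul, mul_apply_eq_comp]

/-- The Clifford mean of the Pauli string `p` acting on the tensor factors `i` and `j`. -/
def pauliMean (i j : Fin t) (ψ : EuclideanSpace ℂ ((Fin t → Bits n) × R)) (p : Fin n → Fin 4) : ℝ :=
  cliffordMean (ampliation _ R (pairOp i j (pauliString p))) ψ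

theorem pauliMean_zero (i j : Fin t) (ψ : EuclideanSpace ℂ ((Fin t → Bits n) × R)) :
    pauliMean i j ψ 0 = ‖ψ‖ ^ 2 := by
  rw [pauliMean, pauliString_zero, pairOp_one, map_one, cliffordMean_one]

-- The Clifford group moves any nontrivial Pauli string to any other, up to a sign which the two
-- factors `i` and `j` cancel; a string anticommuting with both avoids tracking that sign.
theorem pauliMean_eq (i j : Fin t) (ψ : EuclideanSpace ℂ ((Fin t → Bits n) × R))
    {p q : Fin n → Fin 4} (hp : p ≠ 0) (hq : q ≠ 0) : pauliMean i j ψ p = pauliMean i j ψ q := by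
  have hanti : ∀ {p r : Fin n → Fin 4}, stringSign p r = -1 →
      pauliMean i j ψ r = pauliMean i j ψ p := fun {p r} h => by
    obtain ⟨V, hV, hpr⟩ := exists_mem_cliffordGroup_star_mul_pauliString_mul h
    rw [pauliMean, pauliMean, ← hpr, ← star_tensorAct_mul_ampliation_pairOp_mul,
      cliffordMean_star_mul_mul hV]
  obtain ⟨r, hpr, hqr⟩ := exists_stringSign_eq_neg_one hp hq
  exact (hanti hpr).symm.trans (hanti hqr)

theorem norm_ampliation_permMatrix_le {κ : Type*} [Fintype κ] [DecidableEq κ]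
    (σ : Equiv.Perm κ) : ‖ampliation κ R (Equiv.Perm.permMatrix ℂ σ)‖ ≤ 1 := by
  have hσ : Equiv.Perm.permMatrix ℂ σ ∈ unitary (Matrix κ κ ℂ) := by
    rw [Matrix.mem_unitaryGroup_iff, Matrix.star_eq_conjTranspose, Matrix.conjTranspose_permMatrix,
      ← Matrix.permMatrix_mul, inv_mul_cancel, Matrix.permMatrix_one]
  exact norm_le_one_of_mem_unitary (Unitary.map_mem (ampliation κ R) hσ)

theorem sum_pauliMean_le {i j : Fin t} (hij : i ≠ j)
    (ψ : EuclideanSpace ℂ ((Fin t → Bits n) × R)) :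
    ∑ p, pauliMean i j ψ p ≤ 2 ^ n * ‖ψ‖ ^ 2 := by
  simp only [pauliMean, ← cliffordMean_sum, ← map_sum, sum_pairOp_pauliString hij, map_nsmul,
    cliffordMean_nsmul, Nat.cast_pow, Nat.cast_ofNat]
  gcongr
  exact cliffordMean_le (norm_ampliation_permMatrix_le _) ψ

theorem pauliMean_le {i j : Fin t} (hij : i ≠ j)
    (ψ : EuclideanSpace ℂ ((Fin t → Bits n) × R)) {p : Fin n → Fin 4} (hp : p ≠ 0) :
    pauliMean i j ψ p ≤ ‖ψ‖ ^ 2 / 2 ^ n := by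
  have hn : n ≠ 0 := by
    rintro rfl
    exact hp (Subsingleton.elim _ _)
  have hd : (1 : ℝ) < 2 ^ n := one_lt_pow₀ one_lt_two hn
  have hsum := sum_pauliMean_le hij ψ
  rw [← Finset.add_sum_erase _ _ (Finset.mem_univ 0), pauliMean_zero,
    Finset.sum_congr rfl fun q hq => pauliMean_eq i j ψ (Finset.ne_of_mem_erase hq) hp,
    Finset.sum_const, Finset.card_erase_of_mem (Finset.mem_univ _), Finset.card_univ,
    Fintype.card_fun, Fintype.card_fin, Fintype.card_fin, nsmul_eq_mul,
    Nat.cast_pred (by positivity)] at hsum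
  push_cast at hsum
  have hcard : (4 : ℝ) ^ n = 2 ^ n * 2 ^ n := by rw [← mul_pow]; norm_num
  have hle : (2 ^ n + 1) * pauliMean i j ψ p ≤ ‖ψ‖ ^ 2 := by
    rw [hcard] at hsum
    refine le_of_mul_le_mul_left ?_ (sub_pos.2 hd)
    linear_combination hsum
  rw [le_div_iff₀ (by positivity)]
  rcases le_total 0 (pauliMean i j ψ p) with h | h
  · linarith
  · nlinarith [sq_nonneg ‖ψ‖]

theorem cliffordMean_collisionProj_le {i j : Fin t} (hij : i ≠ j)
    (ψ : EuclideanSpace ℂ ((Fin t → Bits n) × R)) :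
    cliffordMean (ampliation _ R (collisionProj i j)) ψ ≤ 2 * ‖ψ‖ ^ 2 / 2 ^ n := by
  have hd : (0 : ℝ) < 2 ^ n := by positivity
  have hz : 2 ^ n * cliffordMean (ampliation _ R (collisionProj i j)) ψ =
      ∑ z : Bits n, pauliMean i j ψ (zString z) := by
    simp only [pauliMean, ← cliffordMean_sum, ← map_sum, sum_pairOp_zString hij, map_nsmul,
      cliffordMean_nsmul, Nat.cast_pow, Nat.cast_ofNat]
  rw [le_div_iff₀' hd, hz, ← Finset.add_sum_erase _ _ (Finset.mem_univ 0), zString_zero,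
    pauliMean_zero, two_mul]
  gcongr
  calc ∑ z ∈ Finset.univ.erase 0, pauliMean i j ψ (zString z)
      ≤ (Finset.univ.erase (0 : Bits n)).card • (‖ψ‖ ^ 2 / 2 ^ n) :=
        Finset.sum_le_card_nsmul _ _ _ fun z hz =>
          pauliMean_le hij ψ (zString_ne_zero (Finset.ne_of_mem_erase hz))
    _ ≤ 2 ^ n * (‖ψ‖ ^ 2 / 2 ^ n) := by
        rw [nsmul_eq_mul]
        gcongr
        exact_mod_cast (Finset.card_erase_le).trans (by simp)
    _ = ‖ψ‖ ^ 2 := mul_div_cancel₀ _ hd.ne'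

end CliffordMean

section Collisions

variable {ι R : Type*} [Fintype ι] [DecidableEq ι] [Fintype R] [DecidableEq R] {t : ℕ}

theorem reApplyInnerSelf_ampliation_collisionProj (i j : Fin t)
    (φ : EuclideanSpace ℂ ((Fin t → ι) × R)) :
    (ampliation _ R (collisionProj i j)).reApplyInnerSelf φ =
      ∑ p, if p.1 i = p.1 j then ‖φ p‖ ^ 2 else 0 := by
  rw [ContinuousLinearMap.reApplyInnerSelf_apply, PiLp.inner_apply, map_sum]
  refine Finset.sum_congr rfl fun p _ => ?_
  rw [collisionProj, ampliation_diagonal_apply, ite_mul, one_mul, zero_mul]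
  split_ifs
  · exact inner_self_eq_norm_sq (𝕜 := ℂ) _
  · simp

theorem norm_sub_distinctProj_apply_sq_le (φ : EuclideanSpace ℂ ((Fin t → ι) × R)) :
    ‖φ - distinctProj ι R t φ‖ ^ 2 ≤ ∑ ij ∈ Finset.univ.offDiag,
      (ampliation _ R (collisionProj ij.1 ij.2)).reApplyInnerSelf φ := by
  simp only [reApplyInnerSelf_ampliation_collisionProj]
  rw [EuclideanSpace.norm_sq_eq, Finset.sum_comm]
  refine Finset.sum_le_sum fun p _ => ?_
  have hnonneg : ∀ ij ∈ (Finset.univ : Finset (Fin t)).offDiag,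
      0 ≤ if p.1 ij.1 = p.1 ij.2 then ‖φ p‖ ^ 2 else 0 := fun ij _ => by positivity
  rw [PiLp.sub_apply, distinctProj_apply]
  by_cases hp : p.1.Injective
  · simpa [hp] using Finset.sum_nonneg hnonneg
  · obtain ⟨i, j, hcoll, hij⟩ := Function.not_injective_iff.1 hp
    simpa [hp, hcoll] using Finset.single_le_sum hnonneg
      (Finset.mem_offDiag (x := (i, j)).2 ⟨Finset.mem_univ i, Finset.mem_univ j, hij⟩)

theorem integral_norm_sub_distinctProj_sq_le {n : ℕ}
    (ψ : EuclideanSpace ℂ ((Fin t → Bits n) × R)) :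
    ∫ C, ‖tensorAct t R C ψ - distinctProj (Bits n) R t (tensorAct t R C ψ)‖ ^ 2
      ∂(cliffordEnsemble n : Measure (QU n)) ≤ 2 * ((t : ℝ) ^ 2 / 2 ^ n) * ‖ψ‖ ^ 2 := by
  have hcont := continuous_tensorAct_apply (t := t) (ι := Bits n) ψ
  have hcoll := fun (ij : Fin t × Fin t) => integrable_of_continuous
    (continuous_reApplyInnerSelf_tensorAct_apply (ampliation _ R (collisionProj ij.1 ij.2)) ψ)
    (cliffordEnsemble n : Measure (QU n))
  calc _ ≤ ∑ ij ∈ Finset.univ.offDiag,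
        cliffordMean (ampliation _ R (collisionProj ij.1 ij.2)) ψ := by
        simp only [cliffordMean]
        rw [← integral_finsetSum _ fun ij _ => hcoll ij]
        exact integral_mono (integrable_of_continuous (by fun_prop) _)
          (integrable_finsetSum _ fun ij _ => hcoll ij)
          fun C => norm_sub_distinctProj_apply_sq_le _
    _ ≤ (Finset.univ : Finset (Fin t)).offDiag.card • (2 * ‖ψ‖ ^ 2 / 2 ^ n) :=
        Finset.sum_le_card_nsmul _ _ _ fun ij hij =>
          cliffordMean_collisionProj_le (Finset.mem_offDiag.1 hij).2.2 ψ
    _ ≤ (t : ℝ) ^ 2 * (2 * ‖ψ‖ ^ 2 / 2 ^ n) := by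
        rw [nsmul_eq_mul]
        gcongr
        rw [Finset.offDiag_card, Finset.card_fin]
        exact_mod_cast (Nat.sub_le _ _).trans (sq t).ge
    _ = 2 * ((t : ℝ) ^ 2 / 2 ^ n) * ‖ψ‖ ^ 2 := by ring

end Collisions

section Main

variable {n t : ℕ} {R : Type*} [Fintype R] [DecidableEq R]

theorem integral_norm_sub_distinctProj_le (ψ : EuclideanSpace ℂ ((Fin t → Bits n) × R)) :
    ∫ C, ‖tensorAct t R C ψ - distinctProj (Bits n) R t (tensorAct t R C ψ)‖
      ∂(cliffordEnsemble n : Measure (QU n)) ≤ √2 * (t / √(2 ^ n)) * ‖ψ‖ := by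
  have hcont := continuous_tensorAct_apply (t := t) (ι := Bits n) ψ
  have hjensen := (even_two.convexOn_pow (𝕜 := ℝ)).map_integral_le
    (μ := (cliffordEnsemble n : Measure (QU n)))
    (f := fun C => ‖tensorAct t R C ψ - distinctProj (Bits n) R t (tensorAct t R C ψ)‖)
    (continuous_pow 2).continuousOn isClosed_univ (by simp)
    (integrable_of_continuous (by fun_prop) _)
    (integrable_of_continuous (by simp only [Function.comp_def]; fun_prop) _)
  refine le_of_sq_le_sq (hjensen.trans ((integral_norm_sub_distinctProj_sq_le ψ).trans_eq ?_))
    (by positivity)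
  simp only [mul_pow, div_pow, Real.sq_sqrt (by positivity : (0 : ℝ) ≤ 2 ^ n),
    Real.sq_sqrt zero_le_two]

theorem integral_reApplyInnerSelf_pfcEnsemble
    (T : EuclideanSpace ℂ ((Fin t → Bits n) × R) →L[ℂ] EuclideanSpace ℂ ((Fin t → Bits n) × R))
    (ψ : EuclideanSpace ℂ ((Fin t → Bits n) × R)) :
    ∫ U, T.reApplyInnerSelf (tensorAct t R U ψ) ∂(pfcEnsemble n : Measure (QU n)) =
      ∫ C, permPhaseMean T (tensorAct t R C ψ) ∂(cliffordEnsemble n : Measure (QU n)) := by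
  rw [integral_pfcEnsemble (continuous_reApplyInnerSelf_tensorAct_apply T ψ)]
  simp only [permPhaseMean, map_mul, mul_apply_eq_comp]

theorem continuous_permPhaseMean
    (T : EuclideanSpace ℂ ((Fin t → Bits n) × R) →L[ℂ] EuclideanSpace ℂ ((Fin t → Bits n) × R)) :
    Continuous (permPhaseMean T) := by
  have hT := T.reApplyInnerSelf_continuous
  unfold permPhaseMean
  simp only [Fintype.expect_eq_sum_div_card]
  fun_prop

variable {T : EuclideanSpace ℂ ((Fin t → Bits n) × R) →L[ℂ] EuclideanSpace ℂ ((Fin t → Bits n) × R)}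

theorem integral_pfcEnsemble_sub_le_two (hT : ‖T‖ ≤ 1) (V : QU n)
    {ψ : EuclideanSpace ℂ ((Fin t → Bits n) × R)} (hψ : ‖ψ‖ = 1) :
    ∫ U, T.reApplyInnerSelf (tensorAct t R U ψ) ∂(pfcEnsemble n : Measure (QU n)) -
      ∫ U, T.reApplyInnerSelf (tensorAct t R (V * U) ψ) ∂(pfcEnsemble n : Measure (QU n)) ≤ 2 := by
  have hbound : ∀ U : QU n, ‖T.reApplyInnerSelf (tensorAct t R U ψ)‖ ≤ 1 := fun U => by
    simpa [norm_tensorAct_apply, hψ] using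
      abs_reApplyInnerSelf_le_of_norm_le_one hT (tensorAct t R U ψ)
  have hU := norm_integral_le_of_norm_le_const (μ := (pfcEnsemble n : Measure (QU n)))
    (ae_of_all _ hbound)
  have hVU := norm_integral_le_of_norm_le_const (μ := (pfcEnsemble n : Measure (QU n)))
    (ae_of_all _ fun U => hbound (V * U))
  rw [probReal_univ, mul_one] at hU hVU
  linarith [(abs_le.1 hU).2, (abs_le.1 hVU).1]

theorem integral_pfcEnsemble_sub_le_factorialDefect (hT : ‖T‖ ≤ 1) (V : QU n)
    {ψ : EuclideanSpace ℂ ((Fin t → Bits n) × R)} (hψ : ‖ψ‖ = 1) :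
    ∫ U, T.reApplyInnerSelf (tensorAct t R U ψ) ∂(pfcEnsemble n : Measure (QU n)) -
      ∫ U, T.reApplyInnerSelf (tensorAct t R (V * U) ψ) ∂(pfcEnsemble n : Measure (QU n)) ≤
      4 * (√2 * (t / √(2 ^ n))) + 2 * factorialDefect (2 ^ n) t := by
  have hcont := continuous_tensorAct_apply (t := t) (ι := Bits n) ψ
  have hmean := fun S => integrable_of_continuous
    ((continuous_permPhaseMean (R := R) S).comp hcont) (cliffordEnsemble n : Measure (QU n))
  have hdist : Integrable (fun C => ‖tensorAct t R C ψ -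
      distinctProj (Bits n) R t (tensorAct t R C ψ)‖) (cliffordEnsemble n : Measure (QU n)) :=
    integrable_of_continuous (by fun_prop) _
  have hcollide := integral_norm_sub_distinctProj_le ψ
  rw [hψ, mul_one] at hcollide
  simp only [map_mul, mul_apply_eq_comp,
    ← reApplyInnerSelf_star_mul_mul (tensorAct t R V)]
  rw [integral_reApplyInnerSelf_pfcEnsemble, integral_reApplyInnerSelf_pfcEnsemble]
  calc _ = ∫ C, (permPhaseMean T (tensorAct t R C ψ) -
        permPhaseMean (star (tensorAct t R V) * T * tensorAct t R V) (tensorAct t R C ψ))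
          ∂(cliffordEnsemble n : Measure (QU n)) := (integral_sub (hmean _) (hmean _)).symm
    _ ≤ ∫ C, (4 * ‖tensorAct t R C ψ - distinctProj (Bits n) R t (tensorAct t R C ψ)‖ +
        2 * factorialDefect (2 ^ n) t) ∂(cliffordEnsemble n : Measure (QU n)) :=
        integral_mono ((hmean _).sub (hmean _)) ((hdist.const_mul _).add (integrable_const _))
          fun C => permPhaseMean_sub_le hT V ((norm_tensorAct_apply C ψ).trans hψ)
    _ ≤ _ := by
        rw [integral_add (hdist.const_mul _) (integrable_const _), integral_const_mul]
        simpa using hcollide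

theorem integral_pfcEnsemble_sub_le (hT : ‖T‖ ≤ 1) (V : QU n)
    {ψ : EuclideanSpace ℂ ((Fin t → Bits n) × R)} (hψ : ‖ψ‖ = 1) :
    ∫ U, T.reApplyInnerSelf (tensorAct t R U ψ) ∂(pfcEnsemble n : Measure (QU n)) -
      ∫ U, T.reApplyInnerSelf (tensorAct t R (V * U) ψ) ∂(pfcEnsemble n : Measure (QU n)) ≤
      10 * (t / √(2 ^ n)) := by
  set s : ℝ := t / √(2 ^ n) with hs
  have hs0 : 0 ≤ s := by positivity
  have hs_sq : s ^ 2 = t ^ 2 / 2 ^ n := by rw [hs, div_pow, Real.sq_sqrt (by positivity)]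
  rcases le_total (1 / 4) s with hlarge | hsmall
  · exact (integral_pfcEnsemble_sub_le_two hT V hψ).trans (by linarith)
  have hroom : 16 * t ^ 2 ≤ 2 ^ n := by
    have hsq : s ^ 2 ≤ (1 / 4) ^ 2 := by gcongr
    rw [hs_sq, div_le_iff₀ (by positivity)] at hsq
    exact_mod_cast (by linarith : (16 : ℝ) * t ^ 2 ≤ 2 ^ n)
  have hdefect : factorialDefect (2 ^ n) t ≤ 8 * s ^ 2 := by
    simpa [hs_sq] using factorialDefect_le hroom
  have hsqrt_two : √2 ≤ 3 / 2 := Real.sqrt_le_iff.2 (by norm_num)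
  calc _ ≤ 4 * (√2 * s) + 2 * factorialDefect (2 ^ n) t :=
        integral_pfcEnsemble_sub_le_factorialDefect hT V hψ
    _ ≤ 4 * (3 / 2 * s) + 2 * (8 * s ^ 2) := by gcongr
    _ ≤ 10 * s := by nlinarith

end Main

end PFC

end

/-- There is a universal constant `c` such that, for all `n` and `t`, the PFC ensemble in
dimension `d = 2^n` is a diamond `c t / √d`-approximate `t`-design. -/
theorem mainTheorem1 :
    ∃ c : ℝ, 0 < c ∧ ∀ n t : ℕ,
      PFC.IsDiamondApproxDesign (PFC.pfcEnsemble n) (c * ((t : ℝ) / Real.sqrt ((2 : ℝ) ^ n))) t := by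
  refine ⟨10, by norm_num, fun n t => PFC.isDiamondApproxDesign_of_mul_left ?_⟩
  intro ψ hψ T hT V
  exact PFC.integral_pfcEnsemble_sub_le hT V hψ
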